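/- **Conventions.** Identify $\mathbb R^4$ with the quaternions $\mathbb H$ by $x=x_1+x_2\mathbf i+x_3\mathbf j+x_4\mathbf k$, $su(2)$ with the imaginary quaternions, $SU(2)$ with the unit quaternions, and a quaternion with the complex $2\times2$ matrix representing it, so that $\mathrm{tr}\,p=2\,\mathrm{Re}\,p$ and $|p|^2=\mathrm{tr}(p\bar p)$. A smooth connection form on $\mathbb R^4$ is $A=\sum_l A^l\,dx_l$ with $A^l\in C^\infty(\mathbb R^4,su(2))$. Its curvature is $F_A^{lm}=\partial_lA^m-\partial_mA^l+[A^l,A^m]$, with $|F_A|^2=\sum_{l<m}|F_A^{lm}|^2$, and $P_\pm=\tfrac12(1\pm\star)$ are the projections of $2$-forms onto the self-dual and anti-self-dual ones for the orientation $dx_1\wedge dx_2\wedge dx_3\wedge dx_4$. Put $YM(A)=\int_{\mathbb R^4}|F_A|^2\,dx^4$. Connection forms $A$ and $B$ are gauge equivalent on a set $S$ if $B=g^{-1}Ag+g^{-1}dg$ on $S$ for some smooth $SU(2)$-valued map $g$ defined on an open neighbourhood of $S$. For $\lambda>0$ let $$SD_\lambda=\mathrm{Im}\Big(\frac{\lambda^2x\,d\bar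 x}{1+\lambda^2|x|^2}\Big),\qquad ASD_\lambda=\mathrm{Im}\Big(\frac{\lambda^2\bar x\,dx}{1+\lambda^2|x|^2}\Big)$$ be the standard self-dual and anti-self-dual instantons. $B_r$ is the open ball of radius $r$ centred at $0$. **Theorem 1.2.** Let $0<b<1<a$. There is $\delta>0$, depending only on $a$ and $b$, with the following two properties. (i) Let $A$ be a smooth connection form on $\mathbb R^4$ with $YM(A)<\infty$ and $P_-F_A(0)\neq0$. Then there are constants $C$ and $\rho_0>0$ (depending on $A$, $a$, $b$) such that for every $0<\rho<\rho_0$ there is a smooth connection form $\hat A$ on $\mathbb R^4$ with $YM(\hat A)<\infty$ such that $\hat A$ is gauge equivalent to $A$ on $\mathbb R^4\setminus B_{\rho^b}$, $\hat A$ is gauge equivalent on $B_{\rho^a}$ to a self-dual instanton $SD_\lambda$ for some $\lambda>0$, $$\int_{\mathbb R^4}\mathrm{tr}(F_{\hat A}\wedge F_{\hat A})=\int_{\mathbb R^4}\mathrm{tr}(F_A\wedge F_A)-8\pi^2,$$ and $$YM(\hat A)\le YM(A)+8\pi^2-\frac{4\pi^2}{\sqrt3}\,|P_-F_A(0)|^2\rho^4+C\rho^{4+\delta}.$$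 (ii) The same holds if $P_+F_A(0)\neq0$ instead, with $SD_\lambda$ replaced by an anti-self-dual instanton $ASD_\lambda$, with $-8\pi^2$ replaced by $+8\pi^2$ in the Chern integral identity, and with $|P_-F_A(0)|^2$ replaced by $|P_+F_A(0)|^2$ in the energy estimate. -/

import Mathlib

open scoped ContDiff

noncomputable section

namespace YangMillsFour

/-- Euclidean four-space, with its Euclidean norm and Lebesgue measure. -/
abbrev E4 : Type := EuclideanSpace ℝ (Fin 4)

/-- The real quaternions. The algebra `su(2)` is the space of quaternions with vanishing real
part, and the group `SU(2)` is the group of quaternions of norm one. -/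
abbrev H : Type := Quaternion ℝ

/-- The coordinate vector field `∂/∂x_l`. -/
def e (l : Fin 4) : E4 := EuclideanSpace.single l 1

/-- The identification `x = x₁ + x₂ i + x₃ j + x₄ k` of four-space with the quaternions. -/
def toQuat (x : E4) : H := ⟨x 0, x 1, x 2, x 3⟩

/-- The trace of the complex `2 × 2` matrix that represents the quaternion `p`. -/
def qtr (p : H) : ℝ := 2 * p.re

/-- `|p|² = tr (p p̄)`; so `|i|² = |j|² = |k|² = 2`. -/
def qnormSq (p : H) : ℝ := qtr (p * star p)

/-- A one-form `A = ∑ A l dx_l` on four-space with quaternionic coefficients `A l`. -/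
abbrev OneForm : Type := Fin 4 → E4 → H

/-- The one-form `A` is a smooth `su(2)`-valued connection form on four-space. -/
def IsConnection (A : OneForm) : Prop :=
  ∀ l, ContDiff ℝ ∞ (A l) ∧ ∀ x, (A l x).re = 0

/-- The components `α l m = α (∂_l, ∂_m)` of a quaternion-valued two-form at a point. -/
abbrev TwoCovector : Type := Fin 4 → Fin 4 → H

/-- The curvature `F^{lm} = ∂_l A^m - ∂_m A^l + [A^l, A^m]` at the point `x`. -/
def curv (A : OneForm) (x : E4) : TwoCovector := fun l m =>
  fderiv ℝ (A m) x (e l) - fderiv ℝ (A l) x (e m) + (A l x * A m x - A m x * A l x)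

/-- The Hodge operator on two-forms of oriented Euclidean four-space: it exchanges
`dx₁ ∧ dx₂` with `dx₃ ∧ dx₄`, `dx₁ ∧ dx₃` with `dx₄ ∧ dx₂`, and `dx₁ ∧ dx₄` with `dx₂ ∧ dx₃`. -/
def hodge (α : TwoCovector) : TwoCovector :=
  ![![0, α 2 3, α 3 1, α 1 2],
    ![α 3 2, 0, α 0 3, α 2 0],
    ![α 1 3, α 3 0, 0, α 0 1],
    ![α 2 1, α 0 2, α 1 0, 0]]

/-- The self-dual part `P₊ α`. -/
def sdPart (α : TwoCovector) : TwoCovector := (1 / 2 : ℝ) • (α + hodge α)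

/-- The anti-self-dual part `P₋ α`. -/
def asdPart (α : TwoCovector) : TwoCovector := (1 / 2 : ℝ) • (α - hodge α)

/-- The norm `|α|² = ∑_{l < m} |α (∂_l, ∂_m)|²`. -/
def twoNormSq (α : TwoCovector) : ℝ :=
  ∑ l : Fin 4, ∑ m : Fin 4, if l < m then qnormSq (α l m) else 0

/-- The coefficient of `tr (α ∧ α)` with respect to `dx₁ ∧ dx₂ ∧ dx₃ ∧ dx₄`. -/
def trWedge (α : TwoCovector) : ℝ :=
  qtr (α 0 1 * α 2 3 - α 0 2 * α 1 3 + α 0 3 * α 1 2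
    + α 1 2 * α 0 3 - α 1 3 * α 0 2 + α 2 3 * α 0 1)

/-- The curvature of `A` is square integrable. -/
def FiniteEnergy (A : OneForm) : Prop :=
  MeasureTheory.Integrable (fun x : E4 => twoNormSq (curv A x)) MeasureTheory.volume

/-- The Yang-Mills energy `∫ |F_A|²`. -/
def YM (A : OneForm) : ℝ := ∫ x : E4, twoNormSq (curv A x)

/-- The Chern integral `∫ tr (F_A ∧ F_A)`. -/
def chern (A : OneForm) : ℝ := ∫ x : E4, trWedge (curv A x)

/-- On the set `S`, `B` is the gauge transform `g⁻¹ A g + g⁻¹ dg` of `A` by a smooth map `g` into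
`SU(2)`, where `g` is defined and smooth on an open set that contains `S`. -/
def GaugeEquivOn (S : Set E4) (A B : OneForm) : Prop :=
  ∃ (U : Set E4) (g : E4 → H), IsOpen U ∧ S ⊆ U ∧ ContDiffOn ℝ ∞ g U ∧ (∀ x ∈ U, ‖g x‖ = 1) ∧
    ∀ x ∈ S, ∀ l, B l x = (g x)⁻¹ * A l x * g x + (g x)⁻¹ * fderiv ℝ g x (e l)

/-- The standard self-dual instanton `Im (s² x dx̄ / (1 + s² |x|²))` of scale `s`. -/
def SD (s : ℝ) : OneForm := fun l x =>
  (s ^ 2 / (1 + s ^ 2 * ‖x‖ ^ 2)) • (toQuat x * star (toQuat (e l))).im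

/-- The standard anti-self-dual instanton `Im (s² x̄ dx / (1 + s² |x|²))` of scale `s`. -/
def ASD (s : ℝ) : OneForm := fun l x =>
  (s ^ 2 / (1 + s ^ 2 * ‖x‖ ^ 2)) • (star (toQuat x) * toQuat (e l)).im

end YangMillsFour

end

/-!
Write `t = |x|²`. Away from the origin, the gauge transformation `x̄ / |x|` turns the self-dual
instanton of size `√m`, which is `Im (x dx̄) / (t + m)`, into its singular gauge
`(1 / t - 1 / (t + m)) Im (x̄ dx)`, which decays like `m / |x|³`. There it can be superposed with
a connection `A` that vanishes at the origin. The glued connection `glue m S T A` is such a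
superposition, written in the gauge that is regular at the origin, with two modifications: `A` is
cut off inside `|x|² ≤ T`, where the result is an instanton, and `t + m` is replaced by
`denom m S t`, which equals `t` for `|x|² ≥ S`, where the result is gauge equivalent to `A`.

*Chern integral.* `tr (F ∧ F)` is the divergence of the Chern-Simons form, so its integral depends
only on the connection near infinity (`chern_eq_of_eq_outside`). Moving the cutoff of `A` outwards
until its support is disjoint from that of the instanton, one is left with a radial integral of an
exact derivative, which is `-8π²` (`chern_glue`).

*Energy.* Since `|F|² = 2 |P₋F|² - tr (F ∧ F)`, only `∫ |P₋F|²` has to be estimated (`YM_eq`). The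
modified instanton has anti-self-dual curvature only in the transition region `S / 2 ≤ |x|² ≤ S`,
where it is `-h dx̄ ∧ dx / 2` with `h ≥ 0` of order `m / S²` (`asdVec_curv_singProfile`). If `P₋F_A(0)`
pairs positively with `dx̄ ∧ dx`, the cross term lowers the energy by a multiple of `m`, while the
core `|x|² ≤ 2 T` costs `O(T²)` and the commutators of `A` with the instanton cost
`O(m S² / T)` (`YM_glue_le`).

The two hypotheses on `A` at the origin are met after a global gauge transformation: it makes `A`
vanish at `0`, and a constant rotation by one of the twelve elements of the tetrahedral group makes
the pairing positive, because that group acts irreducibly on `su(2)` (`exists_pairing_pos`).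

With `m = K ρ⁴`, `S = ρ^(2b)`, `T = ρ^(2a)` and `a`, `b` close to `1`, the errors are `o(ρ⁴)` and the
gain is a constant times `K ρ⁴`. As `K` is free, every multiple of `ρ⁴` can be gained for small `ρ`
(`exists_glued_instanton`); in particular the one with factor `4π² / √3 · |P₋F_A(0)|²`, with no
remainder left over. The anti-self-dual case follows by the reflection `x ↦ x̄`.
-/


noncomputable section

namespace YangMillsFour

open Filter Topology MeasureTheory

/-! ### Two-covectors with values in `su(2)` -/

/-- A two-covector that is alternating and takes values in `su(2)`. -/
structure IsAlt (α : TwoCovector) : Prop where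
  skew : ∀ l m, α l m = -α m l
  re : ∀ l m, (α l m).re = 0

lemma IsAlt.diag {α : TwoCovector} (hα : IsAlt α) (l : Fin 4) : α l l = 0 := by
  have h := hα.skew l l
  rwa [eq_neg_iff_add_eq_zero, ← two_smul ℝ, smul_eq_zero_iff_right two_ne_zero] at h

lemma qnormSq_eq (p : H) : qnormSq p = 2 * ‖p‖ ^ 2 := by
  rw [qnormSq, qtr, ← real_inner_self_eq_norm_sq, Quaternion.inner_def]

lemma qtr_mul_comm (p q : H) : qtr (p * q) = qtr (q * p) := by
  simp only [qtr, Quaternion.re_mul]; ring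

lemma qtr_conj {q : H} (hq : q ≠ 0) (p : H) : qtr (q⁻¹ * p * q) = qtr p := by
  rw [qtr_mul_comm, ← mul_assoc, mul_inv_cancel₀ hq, one_mul]

lemma qtr_add (p q : H) : qtr (p + q) = qtr p + qtr q := by simp [qtr]; ring

lemma qtr_sub (p q : H) : qtr (p - q) = qtr p - qtr q := by simp [qtr]; ring

lemma norm_sq_eq (p : H) : ‖p‖ ^ 2 = p.re ^ 2 + p.imI ^ 2 + p.imJ ^ 2 + p.imK ^ 2 := by
  rw [← real_inner_self_eq_norm_sq, Quaternion.inner_self, Quaternion.normSq_def']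

lemma twoNormSq_expand (α : TwoCovector) :
    twoNormSq α = 2 * (‖α 0 1‖ ^ 2 + ‖α 0 2‖ ^ 2 + ‖α 0 3‖ ^ 2 + ‖α 1 2‖ ^ 2 + ‖α 1 3‖ ^ 2
      + ‖α 2 3‖ ^ 2) := by
  simp [twoNormSq, Fin.sum_univ_four, qnormSq_eq]
  ring

lemma twoNormSq_nonneg (α : TwoCovector) : 0 ≤ twoNormSq α := by
  rw [twoNormSq_expand]; positivity

/-- The components of the anti-self-dual part of `α` along `dx₁ ∧ dx₂ - dx₃ ∧ dx₄` and its cyclic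
companions. -/
def asdVec (α : TwoCovector) : Fin 3 → H :=
  ![(1 / 2 : ℝ) • (α 0 1 - α 2 3), (1 / 2 : ℝ) • (α 0 2 + α 1 3), (1 / 2 : ℝ) • (α 0 3 - α 1 2)]

lemma asdVec_add (α β : TwoCovector) (k : Fin 3) :
    asdVec (α + β) k = asdVec α k + asdVec β k := by
  fin_cases k <;> simp [asdVec] <;> module

lemma twoNormSq_asdPart {α : TwoCovector} (hα : IsAlt α) :
    twoNormSq (asdPart α) = 4 * ∑ k, ‖asdVec α k‖ ^ 2 := by
  have h1 : asdPart α 0 1 = asdVec α 0 := rfl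
  have h2 : asdPart α 0 2 = asdVec α 1 := by
    change (1 / 2 : ℝ) • (α 0 2 - α 3 1) = (1 / 2 : ℝ) • (α 0 2 + α 1 3)
    rw [hα.skew 3 1, sub_neg_eq_add]
  have h3 : asdPart α 0 3 = asdVec α 2 := rfl
  have h4 : asdPart α 2 3 = -asdVec α 0 := by
    change (1 / 2 : ℝ) • (α 2 3 - α 0 1) = -((1 / 2 : ℝ) • (α 0 1 - α 2 3))
    module
  have h5 : asdPart α 1 3 = asdVec α 1 := by
    change (1 / 2 : ℝ) • (α 1 3 - α 2 0) = (1 / 2 : ℝ) • (α 0 2 + α 1 3)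
    rw [hα.skew 2 0, sub_neg_eq_add, add_comm]
  have h6 : asdPart α 1 2 = -asdVec α 2 := by
    change (1 / 2 : ℝ) • (α 1 2 - α 0 3) = -((1 / 2 : ℝ) • (α 0 3 - α 1 2))
    module
  rw [twoNormSq_expand, h1, h2, h3, h4, h5, h6, Fin.sum_univ_three]
  simp only [norm_neg]
  ring

/-- The Yang-Mills density is the Chern density up to sign and twice the anti-self-dual density. -/
lemma twoNormSq_eq_asdPart_sub_trWedge {α : TwoCovector} (hα : IsAlt α) :
    twoNormSq α = 2 * twoNormSq (asdPart α) - trWedge α := by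
  rw [twoNormSq_asdPart hα, twoNormSq_expand, Fin.sum_univ_three]
  simp only [trWedge, asdVec, norm_sq_eq, qtr, Quaternion.re_mul, Quaternion.re_add,
    Quaternion.re_sub, Matrix.cons_val_zero, Matrix.cons_val_one, Matrix.cons_val,
    Quaternion.re_smul, Quaternion.imI_smul, Quaternion.imJ_smul, Quaternion.imK_smul,
    Quaternion.imI_sub, Quaternion.imJ_sub, Quaternion.imK_sub,
    Quaternion.imI_add, Quaternion.imJ_add, Quaternion.imK_add, hα.re, smul_eq_mul]
  ring

lemma abs_trWedge_le {α : TwoCovector} (hα : IsAlt α) : |trWedge α| ≤ twoNormSq α := by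
  have h : ∀ p q : H, p.re = 0 → q.re = 0 → |qtr (p * q)| ≤ ‖p‖ ^ 2 + ‖q‖ ^ 2 := by
    intro p q hp hq
    rw [norm_sq_eq, norm_sq_eq, qtr, Quaternion.re_mul, hp, hq, abs_le]
    constructor <;>
    nlinarith [sq_nonneg (p.imI - q.imI), sq_nonneg (p.imJ - q.imJ), sq_nonneg (p.imK - q.imK),
      sq_nonneg (p.imI + q.imI), sq_nonneg (p.imJ + q.imJ), sq_nonneg (p.imK + q.imK)]
  have e1 : trWedge α = 2 * qtr (α 0 1 * α 2 3) - 2 * qtr (α 0 2 * α 1 3)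
      + 2 * qtr (α 0 3 * α 1 2) := by
    simp only [trWedge, qtr_add, qtr_sub]
    rw [qtr_mul_comm (α 2 3), qtr_mul_comm (α 1 3), qtr_mul_comm (α 1 2)]; ring
  have h1 := abs_le.mp (h _ _ (hα.re 0 1) (hα.re 2 3))
  have h2 := abs_le.mp (h _ _ (hα.re 0 2) (hα.re 1 3))
  have h3 := abs_le.mp (h _ _ (hα.re 0 3) (hα.re 1 2))
  rw [e1, twoNormSq_expand, abs_le]
  constructor <;> linarith

/-- The gauge rotation of a two-covector by a constant quaternion. -/
def conjTwo (q : H) (α : TwoCovector) : TwoCovector := fun l m => q⁻¹ * α l m * q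

lemma norm_conj {q : H} (hq : q ≠ 0) (p : H) : ‖q⁻¹ * p * q‖ = ‖p‖ := by
  rw [norm_mul, norm_mul, norm_inv]
  field_simp [norm_ne_zero_iff.mpr hq]

lemma twoNormSq_conjTwo {q : H} (hq : q ≠ 0) (α : TwoCovector) :
    twoNormSq (conjTwo q α) = twoNormSq α := by
  simp [twoNormSq_expand, conjTwo, norm_conj hq]

lemma conjTwo_mul {q : H} (hq : q ≠ 0) (a b : H) :
    (q⁻¹ * a * q) * (q⁻¹ * b * q) = q⁻¹ * (a * b) * q := by
  simp only [mul_assoc, mul_inv_cancel_left₀ hq]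

lemma trWedge_conjTwo {q : H} (hq : q ≠ 0) (α : TwoCovector) :
    trWedge (conjTwo q α) = trWedge α := by
  simp only [trWedge, conjTwo, conjTwo_mul hq, qtr_add, qtr_sub, qtr_conj hq]

lemma asdVec_conjTwo (q : H) (α : TwoCovector) (k : Fin 3) :
    asdVec (conjTwo q α) k = q⁻¹ * asdVec α k * q := by
  fin_cases k <;> simp [asdVec, conjTwo, mul_sub, sub_mul, mul_add, add_mul]

lemma isAlt_conjTwo {q : H} (hq : q ≠ 0) {α : TwoCovector} (hα : IsAlt α) :
    IsAlt (conjTwo q α) where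
  skew l m := by simp [conjTwo, hα.skew l m]
  re l m := by
    have := qtr_conj hq (α l m)
    simp only [qtr, hα.re l m] at this
    simpa [conjTwo] using this

/-! ### Curvature and gauge transformations -/

lemma curv_congr {A B : OneForm} {x : E4} (h : ∀ᶠ y in 𝓝 x, ∀ l, A l y = B l y) :
    curv A x = curv B x := by
  have h1 : ∀ l, A l =ᶠ[𝓝 x] B l := fun l => h.mono fun y hy => hy l
  funext l m
  simp only [curv, (h1 l).fderiv_eq, (h1 m).fderiv_eq, (h1 l).eq_of_nhds, (h1 m).eq_of_nhds]

lemma fderiv_mul_apply {f g : E4 → H} {x : E4} (hf : DifferentiableAt ℝ f x)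
    (hg : DifferentiableAt ℝ g x) (v : E4) :
    fderiv ℝ (fun y => f y * g y) x v = fderiv ℝ f x v * g x + f x * fderiv ℝ g x v := by
  have h := hf.hasFDerivAt.mul' hg.hasFDerivAt
  have h2 := h.fderiv
  rw [show (fun y => f y * g y) = f * g from rfl, h2]
  simp [add_comm]

lemma fderiv_inv_apply {g : E4 → H} {x : E4} (hg : DifferentiableAt ℝ g x) (hx : g x ≠ 0)
    (v : E4) :
    fderiv ℝ (fun y => (g y)⁻¹) x v = -((g x)⁻¹ * fderiv ℝ g x v * (g x)⁻¹) := by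
  have h := (hasFDerivAt_inv' (𝕜 := ℝ) hx).comp x hg.hasFDerivAt
  have h2 := h.fderiv
  rw [show (fun y => (g y)⁻¹) = Inv.inv ∘ g from rfl, h2]
  simp

lemma differentiableAt_inv_quat {g : E4 → H} {x : E4} (hg : DifferentiableAt ℝ g x)
    (hx : g x ≠ 0) : DifferentiableAt ℝ (fun y => (g y)⁻¹) x :=
  ((hasFDerivAt_inv' (𝕜 := ℝ) hx).comp x hg.hasFDerivAt).differentiableAt

lemma fderiv_fderiv_comm {g : E4 → H} {x : E4} (hg : ContDiffAt ℝ ∞ g x) (v w : E4) :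
    fderiv ℝ (fun y => fderiv ℝ g y v) x w = fderiv ℝ (fun y => fderiv ℝ g y w) x v := by
  have hd : DifferentiableAt ℝ (fderiv ℝ g) x :=
    (hg.fderiv_right (m := 1) (by norm_cast)).differentiableAt one_ne_zero
  have h := hg.isSymmSndFDerivAt
    (by rw [minSmoothness_of_isRCLikeNormedField]; norm_cast) v w
  rw [fderiv_clm_apply hd (differentiableAt_const _), fderiv_clm_apply hd (differentiableAt_const _)]
  simpa using h.symm

lemma differentiableAt_fderiv_apply {g : E4 → H} {x : E4} (hg : ContDiffAt ℝ ∞ g x) (v : E4) :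
    DifferentiableAt ℝ (fun y => fderiv ℝ g y v) x :=
  ((hg.fderiv_right (m := 1) (by norm_cast)).differentiableAt one_ne_zero).clm_apply
    (differentiableAt_const _)

/-- The gauge transform `g⁻¹ A g + g⁻¹ dg`. -/
def gaugeAct (g : E4 → H) (A : OneForm) : OneForm := fun l x =>
  (g x)⁻¹ * A l x * g x + (g x)⁻¹ * fderiv ℝ g x (e l)

lemma fderiv_gaugeAct {g : E4 → H} {A : OneForm} {x : E4} (hg : ContDiffAt ℝ ∞ g x)
    (hx : g x ≠ 0) (hA : ∀ l, DifferentiableAt ℝ (A l) x) (m : Fin 4) (v : E4) :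
    fderiv ℝ (gaugeAct g A m) x v =
      -((g x)⁻¹ * fderiv ℝ g x v * (g x)⁻¹) * (A m x * g x)
      + (g x)⁻¹ * (fderiv ℝ (A m) x v * g x + A m x * fderiv ℝ g x v)
      + (-((g x)⁻¹ * fderiv ℝ g x v * (g x)⁻¹) * fderiv ℝ g x (e m)
      + (g x)⁻¹ * fderiv ℝ (fun y => fderiv ℝ g y (e m)) x v) := by
  have hgd : DifferentiableAt ℝ g x := hg.differentiableAt (by simp)
  have hi := differentiableAt_inv_quat hgd hx
  have hd := differentiableAt_fderiv_apply hg (e m)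
  have e1 : gaugeAct g A m = fun y => (g y)⁻¹ * (A m y * g y) + (g y)⁻¹ * fderiv ℝ g y (e m) := by
    funext y; simp only [gaugeAct, mul_assoc]
  have d1 : DifferentiableAt ℝ (fun y => (g y)⁻¹ * (A m y * g y)) x := hi.mul ((hA m).mul hgd)
  have d2 : DifferentiableAt ℝ (fun y => (g y)⁻¹ * fderiv ℝ g y (e m)) x := hi.mul hd
  have e2 : fderiv ℝ (fun y => A m y * g y) x v = fderiv ℝ (A m) x v * g x
      + A m x * fderiv ℝ g x v := fderiv_mul_apply (hA m) hgd v
  have d3 : DifferentiableAt ℝ (fun y => A m y * g y) x := (hA m).mul hgd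
  rw [e1, fderiv_fun_add d1 d2, add_apply,
    fderiv_mul_apply hi d3, fderiv_mul_apply hi hd, e2,
    fderiv_inv_apply hgd hx]

/-- Gauge covariance of the curvature. -/
lemma curv_gaugeAct {g : E4 → H} {A : OneForm} {x : E4} (hg : ContDiffAt ℝ ∞ g x)
    (hx : g x ≠ 0) (hA : ∀ l, DifferentiableAt ℝ (A l) x) :
    curv (gaugeAct g A) x = conjTwo (g x) (curv A x) := by
  funext l m
  simp only [curv, conjTwo, fderiv_gaugeAct hg hx hA, fderiv_fderiv_comm hg (e m) (e l)]
  simp only [gaugeAct]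
  have c1 : ∀ y, g x * ((g x)⁻¹ * y) = y := fun y => mul_inv_cancel_left₀ hx y
  simp only [mul_add, add_mul, mul_sub, sub_mul, mul_assoc, neg_mul, c1]
  abel

/-- The mixed terms in the curvature of a sum of two one-forms. -/
def mixed (A B : OneForm) (x : E4) : TwoCovector := fun l m =>
  A l x * B m x - B m x * A l x + (B l x * A m x - A m x * B l x)

lemma curv_add {A B : OneForm} {x : E4} (hA : ∀ l, DifferentiableAt ℝ (A l) x)
    (hB : ∀ l, DifferentiableAt ℝ (B l) x) :
    curv (A + B) x = curv A x + curv B x + mixed A B x := by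
  funext l m
  simp only [curv, mixed, Pi.add_apply]
  rw [fderiv_add (hA m) (hB m), fderiv_add (hA l) (hB l)]
  simp only [add_apply]
  noncomm_ring

/-- The continuous linear map `p ↦ Re p`. -/
def reCLM : H →L[ℝ] ℝ := LinearMap.toContinuousLinearMap
  { toFun := fun p => p.re, map_add' := fun _ _ => rfl, map_smul' := fun _ _ => rfl }

lemma reCLM_apply (p : H) : reCLM p = p.re := rfl

lemma re_fderiv {f : E4 → H} {x : E4} (hf : DifferentiableAt ℝ f x)
    (h : ∀ᶠ y in 𝓝 x, (f y).re = 0) (v : E4) : (fderiv ℝ f x v).re = 0 := by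
  have h1 : fderiv ℝ (fun y => reCLM (f y)) x = reCLM.comp (fderiv ℝ f x) :=
    (reCLM.hasFDerivAt.comp x hf.hasFDerivAt).fderiv
  have h2 : (fun y => reCLM (f y)) =ᶠ[𝓝 x] fun _ => 0 := h
  rw [h2.fderiv_eq] at h1
  have h3 := congrArg (fun T => T v) h1
  simpa [reCLM_apply] using h3.symm

lemma isAlt_curv {A : OneForm} {x : E4} (hA : ∀ l, DifferentiableAt ℝ (A l) x)
    (h : ∀ᶠ y in 𝓝 x, ∀ l, (A l y).re = 0) : IsAlt (curv A x) where
  skew l m := by simp only [curv]; abel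
  re l m := by
    simp only [curv, Quaternion.re_add, Quaternion.re_sub, Quaternion.re_mul,
      re_fderiv (hA m) (h.mono fun y hy => hy m), re_fderiv (hA l) (h.mono fun y hy => hy l)]
    ring

lemma IsConnection.differentiableAt {A : OneForm} (hA : IsConnection A) (x : E4) (l : Fin 4) :
    DifferentiableAt ℝ (A l) x := (hA l).1.differentiable (by simp) x

lemma IsConnection.isAlt_curv {A : OneForm} (hA : IsConnection A) (x : E4) :
    IsAlt (curv A x) :=
  YangMillsFour.isAlt_curv (hA.differentiableAt x) (Eventually.of_forall fun y l => (hA l).2 y)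

lemma IsConnection.continuous_curv {A : OneForm} (hA : IsConnection A) (l m : Fin 4) :
    Continuous fun x => curv A x l m := by
  have h1 : ∀ l k, Continuous fun x => fderiv ℝ (A l) x (e k) := fun l k =>
    ((hA l).1.continuous_fderiv (by simp)).clm_apply continuous_const
  have h2 := fun l => (hA l).1.continuous
  simp only [curv]
  exact ((h1 m l).sub (h1 l m)).add (((h2 l).mul (h2 m)).sub ((h2 m).mul (h2 l)))

lemma continuous_qtr : Continuous qtr := continuous_const.mul Quaternion.continuous_re

lemma IsConnection.continuous_trWedge {A : OneForm} (hA : IsConnection A) :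
    Continuous fun x => trWedge (curv A x) := by
  have h := hA.continuous_curv
  unfold trWedge
  exact continuous_qtr.comp (by fun_prop)

lemma IsConnection.continuous_twoNormSq {A : OneForm} (hA : IsConnection A) :
    Continuous fun x => twoNormSq (curv A x) := by
  have h := hA.continuous_curv
  simp only [twoNormSq_expand]
  fun_prop

lemma IsConnection.continuous_asdVec {A : OneForm} (hA : IsConnection A) (k : Fin 3) :
    Continuous fun x => asdVec (curv A x) k := by
  have h := hA.continuous_curv
  fin_cases k <;> simp [asdVec] <;> fun_prop

/-! ### The Chern-Simons current -/

/-- The component of the Chern-Simons form `tr (A ∧ dA + ⅔ A ∧ A ∧ A)` along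
`dx_m ∧ dx_n ∧ dx_p`. -/
def chernSimons (A : OneForm) (m n p : Fin 4) (x : E4) : ℝ :=
  qtr (A m x * (fderiv ℝ (A p) x (e n) - fderiv ℝ (A n) x (e p))
    + A n x * (fderiv ℝ (A m) x (e p) - fderiv ℝ (A p) x (e m))
    + A p x * (fderiv ℝ (A n) x (e m) - fderiv ℝ (A m) x (e n))
    + 2 • (A m x * (A n x * A p x) - A m x * (A p x * A n x)))

/-- The trace as a continuous linear map. -/
def qtrCLM : H →L[ℝ] ℝ := (2 : ℝ) • reCLM

lemma fderiv_qtr {f : E4 → H} {x : E4} (hf : DifferentiableAt ℝ f x) (v : E4) :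
    fderiv ℝ (fun y => qtr (f y)) x v = qtr (fderiv ℝ f x v) := by
  have h1 : fderiv ℝ (fun y => qtrCLM (f y)) x = qtrCLM.comp (fderiv ℝ f x) :=
    (qtrCLM.hasFDerivAt.comp x hf.hasFDerivAt).fderiv
  exact congrArg (fun T => T v) h1

lemma contDiff_chernSimons {A : OneForm} (hA : IsConnection A) (m n p : Fin 4) :
    ContDiff ℝ 1 (chernSimons A m n p) := by
  have h0 : ∀ l, ContDiff ℝ 1 (A l) := fun l => (hA l).1.of_le (by norm_cast)
  have h1 : ∀ l k, ContDiff ℝ 1 fun x => fderiv ℝ (A l) x (e k) := fun l k =>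
    ((hA l).1.fderiv_right (m := 1) (by norm_cast)).clm_apply contDiff_const
  exact qtrCLM.contDiff.comp ((((((h0 m).mul ((h1 p n).sub (h1 n p))).add ((h0 n).mul ((h1 m p).sub (h1 p m)))).add
    ((h0 p).mul ((h1 n m).sub (h1 m n))))).add
    ((((h0 m).mul ((h0 n).mul (h0 p))).sub ((h0 m).mul ((h0 p).mul (h0 n)))).const_smul 2))

lemma fderiv_chernSimons {A : OneForm} (hA : IsConnection A) (l m n p : Fin 4) (x : E4) :
    fderiv ℝ (chernSimons A m n p) x (e l) =
      qtr (fderiv ℝ (A m) x (e l) * (fderiv ℝ (A p) x (e n) - fderiv ℝ (A n) x (e p))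
        + A m x * (fderiv ℝ (fun y => fderiv ℝ (A p) y (e n)) x (e l)
          - fderiv ℝ (fun y => fderiv ℝ (A n) y (e p)) x (e l))
        + (fderiv ℝ (A n) x (e l) * (fderiv ℝ (A m) x (e p) - fderiv ℝ (A p) x (e m))
        + A n x * (fderiv ℝ (fun y => fderiv ℝ (A m) y (e p)) x (e l)
          - fderiv ℝ (fun y => fderiv ℝ (A p) y (e m)) x (e l)))
        + (fderiv ℝ (A p) x (e l) * (fderiv ℝ (A n) x (e m) - fderiv ℝ (A m) x (e n))
        + A p x * (fderiv ℝ (fun y => fderiv ℝ (A n) y (e m)) x (e l)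
          - fderiv ℝ (fun y => fderiv ℝ (A m) y (e n)) x (e l)))
        + 2 • (fderiv ℝ (A m) x (e l) * (A n x * A p x)
            + A m x * (fderiv ℝ (A n) x (e l) * A p x + A n x * fderiv ℝ (A p) x (e l))
          - (fderiv ℝ (A m) x (e l) * (A p x * A n x)
            + A m x * (fderiv ℝ (A p) x (e l) * A n x + A p x * fderiv ℝ (A n) x (e l))))) := by
  have d0 : ∀ k, DifferentiableAt ℝ (A k) x := fun k => hA.differentiableAt x k
  have d1 : ∀ k j, DifferentiableAt ℝ (fun y => fderiv ℝ (A k) y (e j)) x := fun k j =>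
    differentiableAt_fderiv_apply (hA k).1.contDiffAt (e j)
  have dW : ∀ k j, DifferentiableAt ℝ
      (fun y => fderiv ℝ (A k) y (e j) - fderiv ℝ (A j) y (e k)) x := fun k j =>
    (d1 k j).sub (d1 j k)
  have q1 : ∀ k j i, DifferentiableAt ℝ
      (fun y => A i y * (fderiv ℝ (A k) y (e j) - fderiv ℝ (A j) y (e k))) x := fun k j i =>
    (d0 i).mul (dW k j)
  have q2 : ∀ i j, DifferentiableAt ℝ (fun y => A i y * A j y) x := fun i j => (d0 i).mul (d0 j)
  have q3 : ∀ i j k, DifferentiableAt ℝ (fun y => A i y * (A j y * A k y)) x := fun i j k =>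
    (d0 i).mul (q2 j k)
  have q4 : DifferentiableAt ℝ
      (fun y => A m y * (A n y * A p y) - A m y * (A p y * A n y)) x :=
    (q3 m n p).sub (q3 m p n)
  have q5 : DifferentiableAt ℝ
      (fun y => 2 • (A m y * (A n y * A p y) - A m y * (A p y * A n y))) x := q4.const_smul 2
  have r1 := (q1 p n m).fun_add (q1 m p n)
  have r2 := r1.fun_add (q1 n m p)
  unfold chernSimons
  rw [fderiv_qtr (r2.fun_add q5)]
  congr 1
  rw [fderiv_fun_add r2 q5, fderiv_fun_add r1 (q1 n m p), fderiv_fun_add (q1 p n m) (q1 m p n),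
    fderiv_fun_const_smul q4, fderiv_fun_sub (q3 m n p) (q3 m p n)]
  simp only [add_apply, sub_apply, smul_apply]
  rw [fderiv_mul_apply (d0 m) (dW p n), fderiv_mul_apply (d0 n) (dW m p),
    fderiv_mul_apply (d0 p) (dW n m), fderiv_mul_apply (d0 m) (q2 n p),
    fderiv_mul_apply (d0 m) (q2 p n), fderiv_mul_apply (d0 n) (d0 p),
    fderiv_mul_apply (d0 p) (d0 n), fderiv_fun_sub (d1 p n) (d1 n p),
    fderiv_fun_sub (d1 m p) (d1 p m), fderiv_fun_sub (d1 n m) (d1 m n)]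
  simp only [sub_apply]

/-- `tr (F ∧ F)` is the exterior derivative of the Chern-Simons form. -/
lemma trWedge_curv_eq_div {A : OneForm} (hA : IsConnection A) (x : E4) :
    trWedge (curv A x) = fderiv ℝ (chernSimons A 1 2 3) x (e 0)
      - fderiv ℝ (chernSimons A 0 2 3) x (e 1) + fderiv ℝ (chernSimons A 0 1 3) x (e 2)
      - fderiv ℝ (chernSimons A 0 1 2) x (e 3) := by
  simp only [fderiv_chernSimons hA]
  have hs : ∀ k i j, fderiv ℝ (fun y => fderiv ℝ (A k) y (e i)) x (e j)
      = fderiv ℝ (fun y => fderiv ℝ (A k) y (e j)) x (e i) := fun k i j =>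
    fderiv_fderiv_comm (hA k).1.contDiffAt (e i) (e j)
  rw [hs 2 1 0, hs 3 1 0, hs 3 2 0, hs 1 2 0, hs 1 3 0, hs 2 3 0, hs 3 2 1, hs 2 3 1,
    hs 0 2 1, hs 0 3 1, hs 0 3 2, hs 1 3 2]
  simp only [trWedge, curv, mul_add, add_mul, mul_sub, sub_mul, qtr_add, qtr_sub, two_smul,
    mul_assoc]
  generalize A 0 x = a0
  generalize A 1 x = a1
  generalize A 2 x = a2
  generalize A 3 x = a3
  generalize fderiv ℝ (A 0) x (e 1) = d10
  generalize fderiv ℝ (A 0) x (e 2) = d20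
  generalize fderiv ℝ (A 0) x (e 3) = d30
  generalize fderiv ℝ (A 1) x (e 0) = d01
  generalize fderiv ℝ (A 1) x (e 2) = d21
  generalize fderiv ℝ (A 1) x (e 3) = d31
  generalize fderiv ℝ (A 2) x (e 0) = d02
  generalize fderiv ℝ (A 2) x (e 1) = d12
  generalize fderiv ℝ (A 2) x (e 3) = d32
  generalize fderiv ℝ (A 3) x (e 0) = d03
  generalize fderiv ℝ (A 3) x (e 1) = d13
  generalize fderiv ℝ (A 3) x (e 2) = d23
  simp only [qtr, Quaternion.re_mul, Quaternion.imI_mul, Quaternion.imJ_mul, Quaternion.imK_mul]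
  ring

/-! ### The Chern integral and the energy -/

lemma integral_fderiv_eq_zero {f : E4 → ℝ} (hf : ContDiff ℝ 1 f) (hc : HasCompactSupport f)
    (v : E4) : ∫ x, fderiv ℝ f x v = 0 := by
  have hi : Integrable fun x => fderiv ℝ f x v :=
    ((hf.continuous_fderiv one_ne_zero).clm_apply continuous_const).integrable_of_hasCompactSupport
      (hc.fderiv_apply ℝ v)
  have h := integral_mul_fderiv_eq_neg_fderiv_mul_of_integrable (μ := (volume : Measure E4))
    (f := fun _ => (1 : ℝ)) (g := f) (v := v) (by simp) (by simpa using hi)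
    (by simpa using hf.continuous.integrable_of_hasCompactSupport hc)
    (fun x _ => differentiableAt_const _) (fun x _ => hf.differentiable one_ne_zero x)
  simpa using h

lemma hasCompactSupport_of_eq_zero {f : E4 → ℝ} {R : ℝ} (h : ∀ x, R < ‖x‖ → f x = 0) :
    HasCompactSupport f := by
  refine HasCompactSupport.intro (isCompact_closedBall (0 : E4) R) fun x hx => h x ?_
  simpa using hx

lemma eventually_lt_norm {R : ℝ} {x : E4} (hx : R < ‖x‖) : ∀ᶠ y in 𝓝 x, R < ‖y‖ :=
  continuous_norm.continuousAt.eventually (lt_mem_nhds hx)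

lemma finiteEnergy_of_eq_outside {A B : OneForm} (hA : IsConnection A) (hB : IsConnection B)
    {R : ℝ} (h : ∀ x, R < ‖x‖ → twoNormSq (curv A x) = twoNormSq (curv B x))
    (hi : FiniteEnergy A) : FiniteEnergy B := by
  have h1 : Integrable fun x => twoNormSq (curv B x) - twoNormSq (curv A x) :=
    (hB.continuous_twoNormSq.sub hA.continuous_twoNormSq).integrable_of_hasCompactSupport
      (hasCompactSupport_of_eq_zero fun x hx => sub_eq_zero.mpr (h x hx).symm)
  refine (h1.add hi).congr (Eventually.of_forall fun x => ?_)
  simp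

lemma IsConnection.integrable_trWedge {A : OneForm} (hA : IsConnection A) (hi : FiniteEnergy A) :
    Integrable fun x => trWedge (curv A x) :=
  hi.mono' hA.continuous_trWedge.aestronglyMeasurable
    (Eventually.of_forall fun x => abs_trWedge_le (hA.isAlt_curv x))

lemma IsConnection.integrable_twoNormSq_asdPart {A : OneForm} (hA : IsConnection A)
    (hi : FiniteEnergy A) : Integrable fun x => twoNormSq (asdPart (curv A x)) := by
  refine ((hi.add (hA.integrable_trWedge hi)).const_mul (1 / 2)).congr
    (Eventually.of_forall fun x => ?_)
  simp only [Pi.add_apply, twoNormSq_eq_asdPart_sub_trWedge (hA.isAlt_curv x)]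
  ring

/-- The Yang-Mills energy is twice the energy of the anti-self-dual part, up to the topological
Chern term. -/
lemma YM_eq {A : OneForm} (hA : IsConnection A) (hi : FiniteEnergy A) :
    YM A = 2 * (∫ x, twoNormSq (asdPart (curv A x))) - chern A := by
  have h1 := (hA.integrable_twoNormSq_asdPart hi).const_mul 2
  rw [YM, chern, ← integral_const_mul, ← integral_sub h1 (hA.integrable_trWedge hi)]
  exact integral_congr_ae (Eventually.of_forall fun x =>
    twoNormSq_eq_asdPart_sub_trWedge (hA.isAlt_curv x))

lemma chernSimons_congr {A B : OneForm} {x : E4} (h : ∀ᶠ y in 𝓝 x, ∀ l, A l y = B l y)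
    (m n p : Fin 4) : chernSimons A m n p x = chernSimons B m n p x := by
  have h1 : ∀ l, A l =ᶠ[𝓝 x] B l := fun l => h.mono fun y hy => hy l
  simp only [chernSimons, (h1 _).fderiv_eq, (h1 _).eq_of_nhds]

/-- The Chern integral depends only on the connection near infinity. -/
lemma chern_eq_of_eq_outside {A B : OneForm} (hA : IsConnection A) (hB : IsConnection B)
    {R : ℝ} (h : ∀ x, R < ‖x‖ → ∀ l, A l x = B l x) (hi : FiniteEnergy A) :
    chern B = chern A := by
  have hAB : ∀ x, R < ‖x‖ → ∀ᶠ y in 𝓝 x, ∀ l, A l y = B l y := fun x hx =>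
    (eventually_lt_norm hx).mono h
  have hiB : FiniteEnergy B :=
    finiteEnergy_of_eq_outside hA hB (fun x hx => by rw [curv_congr (hAB x hx)]) hi
  have key : ∀ m n p l, ∫ x, fderiv ℝ (fun y => chernSimons B m n p y - chernSimons A m n p y) x
      (e l) = 0 := fun m n p l =>
    integral_fderiv_eq_zero ((contDiff_chernSimons hB m n p).sub (contDiff_chernSimons hA m n p))
      (hasCompactSupport_of_eq_zero fun x hx => by
        rw [chernSimons_congr (hAB x hx), sub_self]) (e l)
  have hint : ∀ m n p l, Integrable fun x =>
      fderiv ℝ (fun y => chernSimons B m n p y - chernSimons A m n p y) x (e l) := by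
    intro m n p l
    have hf := (contDiff_chernSimons hB m n p).sub (contDiff_chernSimons hA m n p)
    have hc : HasCompactSupport fun y => chernSimons B m n p y - chernSimons A m n p y :=
      hasCompactSupport_of_eq_zero (R := R) fun x hx => by
        rw [chernSimons_congr (hAB x hx), sub_self]
    exact ((hf.continuous_fderiv one_ne_zero).clm_apply
      continuous_const).integrable_of_hasCompactSupport (hc.fderiv_apply ℝ (e l))
  have hsub : ∀ m n p x, fderiv ℝ (fun y => chernSimons B m n p y - chernSimons A m n p y) x
      = fderiv ℝ (chernSimons B m n p) x - fderiv ℝ (chernSimons A m n p) x := fun m n p x =>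
    fderiv_fun_sub ((contDiff_chernSimons hB m n p).differentiable one_ne_zero x)
      ((contDiff_chernSimons hA m n p).differentiable one_ne_zero x)
  rw [← sub_eq_zero, chern, chern, ← integral_sub (hB.integrable_trWedge hiB)
    (hA.integrable_trWedge hi)]
  have e1 : ∀ x, trWedge (curv B x) - trWedge (curv A x)
      = (fderiv ℝ (fun y => chernSimons B 1 2 3 y - chernSimons A 1 2 3 y) x (e 0)
        - fderiv ℝ (fun y => chernSimons B 0 2 3 y - chernSimons A 0 2 3 y) x (e 1))
        + (fderiv ℝ (fun y => chernSimons B 0 1 3 y - chernSimons A 0 1 3 y) x (e 2)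
        - fderiv ℝ (fun y => chernSimons B 0 1 2 y - chernSimons A 0 1 2 y) x (e 3)) := by
    intro x
    rw [trWedge_curv_eq_div hA, trWedge_curv_eq_div hB]
    simp only [hsub, sub_apply]
    ring
  have d1 := (hint 1 2 3 0).sub (hint 0 2 3 1)
  have d2 := (hint 0 1 3 2).sub (hint 0 1 2 3)
  simp only [e1]
  refine (integral_add d1 d2).trans ?_
  refine (congrArg₂ _ (integral_sub (hint 1 2 3 0) (hint 0 2 3 1))
    (integral_sub (hint 0 1 3 2) (hint 0 1 2 3))).trans ?_
  rw [key, key, key, key]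
  simp

/-! ### Radially symmetric connections in the singular gauge -/

@[simp] lemma re_toQuat (x : E4) : (toQuat x).re = x 0 := rfl
@[simp] lemma imI_toQuat (x : E4) : (toQuat x).imI = x 1 := rfl
@[simp] lemma imJ_toQuat (x : E4) : (toQuat x).imJ = x 2 := rfl
@[simp] lemma imK_toQuat (x : E4) : (toQuat x).imK = x 3 := rfl

lemma e_apply (l m : Fin 4) : e l m = if m = l then 1 else 0 := by
  simp [e]

/-- `toQuat` as a continuous linear map. -/
def toQuatL : E4 →L[ℝ] H := LinearMap.toContinuousLinearMap
  { toFun := toQuat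
    map_add' := fun x y => by ext <;> simp
    map_smul' := fun c x => by ext <;> simp }

lemma norm_toQuat (x : E4) : ‖toQuat x‖ = ‖x‖ := by
  rw [← sq_eq_sq₀ (norm_nonneg _) (norm_nonneg _), norm_sq_eq, EuclideanSpace.norm_sq_eq]
  simp [Fin.sum_univ_four, toQuat]

lemma norm_sq_E4 (x : E4) : ‖x‖ ^ 2 = x 0 ^ 2 + x 1 ^ 2 + x 2 ^ 2 + x 3 ^ 2 := by
  rw [EuclideanSpace.norm_sq_eq]; simp [Fin.sum_univ_four]

/-- The quaternion units `i`, `j`, `k`. -/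
def unitIm (k : Fin 3) : H := toQuat (e k.succ)

/-- The `su(2)`-valued one-form `Im (x̄ dx)`. -/
def eta : OneForm := fun l x => (star (toQuat x) * toQuat (e l)).im

/-- The linear map `x ↦ Im (x̄ e_l)`. -/
def etaL (l : Fin 4) : E4 →L[ℝ] H := LinearMap.toContinuousLinearMap
  { toFun := eta l
    map_add' := fun x y => by ext <;> simp [eta] <;> ring
    map_smul' := fun c x => by ext <;> simp [eta] <;> ring }

lemma etaL_apply (l : Fin 4) (x : E4) : etaL l x = eta l x := rfl

/-- The radially symmetric form `v(|x|²) Im (x̄ dx)`. -/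
def radialForm (v : ℝ → ℝ) : OneForm := fun l x => v (‖x‖ ^ 2) • eta l x

lemma hasFDerivAt_comp_normSq {v : ℝ → ℝ} {v' : ℝ} {x : E4}
    (hv : HasDerivAt v v' (‖x‖ ^ 2)) :
    HasFDerivAt (fun y : E4 => v (‖y‖ ^ 2)) (v' • (2 : ℝ) • innerSL ℝ x) x := by
  have h1 : HasFDerivAt (fun y : E4 => ‖y‖ ^ 2) ((2 : ℝ) • innerSL ℝ x) x := by
    simpa only [ofNat_smul_eq_nsmul] using (hasStrictFDerivAt_norm_sq x).hasFDerivAt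
  exact hv.comp_hasFDerivAt x h1

lemma inner_e (x : E4) (l : Fin 4) : inner ℝ x (e l) = x l := by
  simp [e, EuclideanSpace.inner_single_right]

lemma hasFDerivAt_radialForm {v : ℝ → ℝ} {v' : ℝ} {x : E4}
    (hv : HasDerivAt v v' (‖x‖ ^ 2)) (m : Fin 4) :
    HasFDerivAt (radialForm v m)
      (v (‖x‖ ^ 2) • etaL m + (v' • (2 : ℝ) • innerSL ℝ x).smulRight (eta m x)) x :=
  (hasFDerivAt_comp_normSq hv).smul (etaL m).hasFDerivAt

lemma fderiv_radialForm {v : ℝ → ℝ} {v' : ℝ} {x : E4}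
    (hv : HasDerivAt v v' (‖x‖ ^ 2)) (l m : Fin 4) :
    fderiv ℝ (radialForm v m) x (e l)
      = v (‖x‖ ^ 2) • eta m (e l) + (v' * (2 * x l)) • eta m x := by
  rw [(hasFDerivAt_radialForm hv m).fderiv]
  simp [etaL_apply, inner_e]

lemma curv_radialForm {v : ℝ → ℝ} {v' : ℝ} {x : E4}
    (hv : HasDerivAt v v' (‖x‖ ^ 2)) (l m : Fin 4) :
    curv (radialForm v) x l m = v (‖x‖ ^ 2) • (eta m (e l) - eta l (e m))
      + (2 * v') • (x l • eta m x - x m • eta l x)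
      + v (‖x‖ ^ 2) ^ 2 • (eta l x * eta m x - eta m x * eta l x) := by
  simp only [curv, fderiv_radialForm hv]
  simp only [radialForm, smul_mul_smul_comm]
  module

lemma asdVec_curv_radialForm {v : ℝ → ℝ} {v' : ℝ} {x : E4}
    (hv : HasDerivAt v v' (‖x‖ ^ 2)) (k : Fin 3) :
    asdVec (curv (radialForm v) x) k =
      (2 * v (‖x‖ ^ 2) + ‖x‖ ^ 2 * (v' - v (‖x‖ ^ 2) ^ 2)) • unitIm k := by
  generalize hc : v (‖x‖ ^ 2) = c
  have h := curv_radialForm hv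
  rw [hc] at h
  rw [norm_sq_E4]
  fin_cases k <;>
  · simp only [asdVec, h, unitIm, Fin.zero_eta, Fin.mk_one, Fin.reduceFinMk, Matrix.cons_val_zero,
      Matrix.cons_val_one, Matrix.cons_val, eta]
    ext <;> simp [e_apply] <;> ring

lemma trWedge_curv_radialForm {v : ℝ → ℝ} {v' : ℝ} {x : E4}
    (hv : HasDerivAt v v' (‖x‖ ^ 2)) :
    trWedge (curv (radialForm v) x) =
      48 * (v (‖x‖ ^ 2) * (1 - ‖x‖ ^ 2 * v (‖x‖ ^ 2)) * (v (‖x‖ ^ 2) + ‖x‖ ^ 2 * v')) := by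
  generalize hc : v (‖x‖ ^ 2) = c
  have h := curv_radialForm hv
  rw [hc] at h
  rw [norm_sq_E4]
  simp only [trWedge, qtr, h, eta]
  simp [e_apply]
  ring

/-! ### Radial profiles -/

section

/-- A smooth decreasing function of `t` that is `1` for `t ≤ S / 2` and `0` for `t ≥ S`. -/
def outerCut (S t : ℝ) : ℝ := Real.smoothTransition (2 - 2 * (t / S))

/-- A smooth increasing function of `t` that is `0` for `t ≤ T` and `1` for `t ≥ 2 * T`. -/
def innerCut (T t : ℝ) : ℝ := Real.smoothTransition (t / T - 1)

/-- The denominator of the modified instanton: it is `t + m` near the origin, as for the instanton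
of scale `m ^ (-1 / 2)`, and `t` for `t ≥ S`, as for a pure gauge. -/
def denom (m S t : ℝ) : ℝ := t + m * outerCut S t

/-- The profile `1 / t - 1 / denom m S t` of the modified instanton in the singular gauge. -/
def singProfile (m S t : ℝ) : ℝ := m * outerCut S t / (denom m S t * t)

lemma contDiff_outerCut (S : ℝ) : ContDiff ℝ ∞ (outerCut S) :=
  Real.smoothTransition.contDiff.comp (contDiff_const.sub (contDiff_const.mul
    (contDiff_id.div_const S)))

lemma contDiff_innerCut (T : ℝ) : ContDiff ℝ ∞ (innerCut T) :=
  Real.smoothTransition.contDiff.comp ((contDiff_id.div_const T).sub contDiff_const)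

lemma outerCut_nonneg (S t : ℝ) : 0 ≤ outerCut S t := Real.smoothTransition.nonneg _

lemma outerCut_le_one (S t : ℝ) : outerCut S t ≤ 1 := Real.smoothTransition.le_one _

lemma innerCut_nonneg (T t : ℝ) : 0 ≤ innerCut T t := Real.smoothTransition.nonneg _

lemma innerCut_le_one (T t : ℝ) : innerCut T t ≤ 1 := Real.smoothTransition.le_one _

variable {m S T t : ℝ}

lemma outerCut_eq_one (hS : 0 < S) (h : t ≤ S / 2) : outerCut S t = 1 := by
  refine Real.smoothTransition.one_of_one_le ?_
  have : t / S ≤ 1 / 2 := by rw [div_le_iff₀ hS]; linarith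
  linarith

lemma outerCut_eq_zero (hS : 0 < S) (h : S ≤ t) : outerCut S t = 0 := by
  refine Real.smoothTransition.zero_of_nonpos ?_
  have : 1 ≤ t / S := by rw [le_div_iff₀ hS]; linarith
  linarith

lemma innerCut_eq_zero (hT : 0 < T) (h : t ≤ T) : innerCut T t = 0 := by
  refine Real.smoothTransition.zero_of_nonpos ?_
  have : t / T ≤ 1 := by rw [div_le_iff₀ hT]; linarith
  linarith

lemma innerCut_eq_one (hT : 0 < T) (h : 2 * T ≤ t) : innerCut T t = 1 := by
  refine Real.smoothTransition.one_of_one_le ?_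
  have : 2 ≤ t / T := by rw [le_div_iff₀ hT]; linarith
  linarith

lemma hasDerivAt_outerCut (S t : ℝ) : HasDerivAt (outerCut S) (deriv (outerCut S) t) t :=
  ((contDiff_outerCut S).differentiable (by simp) t).hasDerivAt

lemma antitone_outerCut (hS : 0 < S) : Antitone (outerCut S) := by
  intro s t hst
  refine Real.smoothTransition.monotone ?_
  have := div_le_div_of_nonneg_right hst hS.le
  linarith

lemma deriv_outerCut_nonpos (hS : 0 < S) (t : ℝ) : deriv (outerCut S) t ≤ 0 :=
  (antitone_outerCut hS).deriv_nonpos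

lemma deriv_outerCut_eq_zero (hS : 0 < S) (h : t < S / 2) : deriv (outerCut S) t = 0 := by
  have : outerCut S =ᶠ[𝓝 t] fun _ => 1 :=
    (gt_mem_nhds h).mono fun s hs => outerCut_eq_one hS (le_of_lt hs)
  rw [this.deriv_eq, deriv_const]

lemma denom_pos (hm : 0 < m) (hS : 0 < S) (ht : 0 ≤ t) : 0 < denom m S t := by
  unfold denom
  rcases le_or_gt t (S / 2) with h | h
  · rw [outerCut_eq_one hS h]; linarith
  · have := mul_nonneg hm.le (outerCut_nonneg S t)
    linarith

lemma le_denom (hm : 0 < m) : t ≤ denom m S t :=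
  le_add_of_nonneg_right (mul_nonneg hm.le (outerCut_nonneg S t))

lemma denom_le (hm : 0 < m) : denom m S t ≤ t + m := by
  have := mul_le_mul_of_nonneg_left (outerCut_le_one S t) hm.le
  unfold denom; linarith

lemma contDiff_denom (m S : ℝ) : ContDiff ℝ ∞ (denom m S) :=
  contDiff_id.add (contDiff_const.mul (contDiff_outerCut S))

lemma hasDerivAt_denom (m S t : ℝ) :
    HasDerivAt (denom m S) (1 + m * deriv (outerCut S) t) t :=
  (hasDerivAt_id t).add ((hasDerivAt_outerCut S t).const_mul m)

lemma hasDerivAt_singProfile (hm : 0 < m) (hS : 0 < S) (ht : 0 < t) :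
    HasDerivAt (singProfile m S)
      ((m * deriv (outerCut S) t * (denom m S t * t) - m * outerCut S t *
        ((1 + m * deriv (outerCut S) t) * t + denom m S t * 1)) / (denom m S t * t) ^ 2) t :=
  ((hasDerivAt_outerCut S t).const_mul m).div ((hasDerivAt_denom m S t).mul (hasDerivAt_id t))
    (mul_pos (denom_pos hm hS ht.le) ht).ne'

/-- The anti-self-dual part of the curvature of the modified instanton is carried by the
transition region `S / 2 ≤ |x|² ≤ S`, where it is a nonnegative multiple of `-dx̄ ∧ dx`. -/
lemma asdVec_curv_singProfile (hm : 0 < m) (hS : 0 < S) {x : E4} (hx : x ≠ 0) (k : Fin 3) :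
    asdVec (curv (radialForm (singProfile m S)) x) k =
      (‖x‖ ^ 2 * m * deriv (outerCut S) (‖x‖ ^ 2) / denom m S (‖x‖ ^ 2) ^ 2) • unitIm k := by
  have ht : 0 < ‖x‖ ^ 2 := by positivity
  rw [asdVec_curv_radialForm (hasDerivAt_singProfile hm hS ht)]
  congr 1
  have hd := (denom_pos hm hS ht.le).ne'
  have hdd : m * outerCut S (‖x‖ ^ 2) = denom m S (‖x‖ ^ 2) - ‖x‖ ^ 2 := by unfold denom; ring
  rw [singProfile, hdd]
  generalize denom m S (‖x‖ ^ 2) = u at *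
  generalize ‖x‖ ^ 2 = t at *
  field_simp
  ring

/-- The Chern density of the modified instanton, as a function of `t = |x|²`. -/
def chernDensity (m S t : ℝ) : ℝ :=
  48 * m ^ 2 * outerCut S t * (deriv (outerCut S) t * t - outerCut S t) / denom m S t ^ 4

lemma trWedge_curv_singProfile (hm : 0 < m) (hS : 0 < S) {x : E4} (hx : x ≠ 0) :
    trWedge (curv (radialForm (singProfile m S)) x) = chernDensity m S (‖x‖ ^ 2) := by
  have ht : 0 < ‖x‖ ^ 2 := by positivity
  rw [trWedge_curv_radialForm (hasDerivAt_singProfile hm hS ht)]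
  have hd := (denom_pos hm hS ht.le).ne'
  have hdd : ‖x‖ ^ 2 = denom m S (‖x‖ ^ 2) - m * outerCut S (‖x‖ ^ 2) := by unfold denom; ring
  rw [chernDensity, singProfile]
  generalize denom m S (‖x‖ ^ 2) = u at *
  generalize ‖x‖ ^ 2 = t at *
  generalize outerCut S t = c at *
  generalize deriv (outerCut S) t = c' at *
  subst hdd
  field_simp
  ring

/-- `r³ · chernDensity (r²)` is the derivative of `12 w² - 8 w³`, where `w = m · outerCut / denom`
falls from `1` to `0`. -/
lemma integral_chernDensity (hm : 0 < m) (hS : 0 < S) :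
    ∫ r in Set.Ioi (0 : ℝ), r ^ 3 * chernDensity m S (r ^ 2) = -4 := by
  set w : ℝ → ℝ := fun t => m * outerCut S t / denom m S t with hw
  have hdw : ∀ t, 0 ≤ t → HasDerivAt w
      ((m * deriv (outerCut S) t * denom m S t - m * outerCut S t *
        (1 + m * deriv (outerCut S) t)) / denom m S t ^ 2) t := fun t ht =>
    ((hasDerivAt_outerCut S t).const_mul m).div (hasDerivAt_denom m S t) (denom_pos hm hS ht).ne'
  set G : ℝ → ℝ := fun r => 12 * w (r ^ 2) ^ 2 - 8 * w (r ^ 2) ^ 3 with hG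
  have hdG : ∀ r ∈ Set.Ici (0 : ℝ), HasDerivAt G (r ^ 3 * chernDensity m S (r ^ 2)) r := by
    intro r _
    have h2 : HasDerivAt (fun r : ℝ => r ^ 2) (2 * r) r := by simpa using hasDerivAt_pow 2 r
    have h3 := HasDerivAt.comp (h₂ := w) (h := fun r : ℝ => r ^ 2) r
      (hdw (r ^ 2) (sq_nonneg r)) h2
    have h4 := ((h3.pow 2).const_mul 12).sub ((h3.pow 3).const_mul 8)
    refine HasDerivAt.congr_deriv h4 ?_
    have hd := (denom_pos hm hS (sq_nonneg r)).ne'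
    have hdd : r ^ 2 = denom m S (r ^ 2) - m * outerCut S (r ^ 2) := by unfold denom; ring
    rw [chernDensity, show r ^ 3 = r * r ^ 2 by ring]
    simp only [Function.comp, hw, Nat.cast_ofNat, Nat.add_one_sub_one, pow_one]
    generalize denom m S (r ^ 2) = u at *
    generalize outerCut S (r ^ 2) = c at *
    generalize deriv (outerCut S) (r ^ 2) = c' at *
    rw [hdd]
    field_simp
    ring
  have hneg : ∀ r ∈ Set.Ioi (0 : ℝ), r ^ 3 * chernDensity m S (r ^ 2) ≤ 0 := by
    intro r hr
    have hr0 : 0 < r := hr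
    have h1 := denom_pos hm hS (sq_nonneg r)
    have h2 := deriv_outerCut_nonpos hS (r ^ 2)
    have h3 := outerCut_nonneg S (r ^ 2)
    have h4 : deriv (outerCut S) (r ^ 2) * r ^ 2 - outerCut S (r ^ 2) ≤ 0 := by
      have := mul_nonpos_of_nonpos_of_nonneg h2 (sq_nonneg r)
      linarith
    refine mul_nonpos_of_nonneg_of_nonpos (by positivity) ?_
    exact div_nonpos_of_nonpos_of_nonneg
      (mul_nonpos_of_nonneg_of_nonpos (by positivity) h4) (by positivity)
  have hlim : Tendsto G atTop (𝓝 0) := by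
    refine tendsto_const_nhds.congr' ?_
    filter_upwards [eventually_ge_atTop (S + 1)] with r hr
    have h1 : S ≤ r ^ 2 := by nlinarith
    simp [hG, hw, outerCut_eq_zero hS h1]
  rw [integral_Ioi_of_hasDerivAt_of_nonpos' hdG hneg hlim]
  have h0 : w 0 = 1 := by
    simp [hw, denom, outerCut_eq_one hS (by linarith : (0 : ℝ) ≤ S / 2), hm.ne']
  simp [hG, h0]
  norm_num

lemma integral_chernDensity_normSq (hm : 0 < m) (hS : 0 < S) :
    ∫ x : E4, chernDensity m S (‖x‖ ^ 2) = -(8 * Real.pi ^ 2) := by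
  have h := integral_fun_norm_addHaar (volume : Measure E4) fun r => chernDensity m S (r ^ 2)
  have hv : (volume : Measure E4).real (Metric.ball 0 1) = Real.pi ^ 2 / 2 := by
    rw [Measure.real, InnerProductSpace.volume_ball_of_dim_even (k := 2) (by simp)]
    simp
    positivity
  rw [h, hv]
  simp only [finrank_euclideanSpace, Fintype.card_fin, smul_eq_mul, Nat.add_one_sub_one]
  rw [integral_chernDensity hm hS]
  simp
  ring

lemma integral_trWedge_singProfile (hm : 0 < m) (hS : 0 < S) :
    ∫ x : E4, trWedge (curv (radialForm (singProfile m S)) x) = -(8 * Real.pi ^ 2) := by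
  rw [← integral_chernDensity_normSq hm hS]
  refine integral_congr_ae ?_
  filter_upwards [compl_mem_ae_iff.mpr (measure_singleton (0 : E4))] with x hx
  exact trWedge_curv_singProfile hm hS hx

end

open scoped Quaternion

/-! ### The glued connection -/

section

lemma toQuat_mul_star_self (x : E4) : toQuat x * star (toQuat x) = (‖x‖ ^ 2) • (1 : H) := by
  rw [norm_sq_E4]; ext <;> simp <;> ring

lemma conj_eta (l : Fin 4) (x : E4) : toQuat x * (eta l x * star (toQuat x)) =
    -((‖x‖ ^ 2) • (toQuat x * star (toQuat (e l))).im) := by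
  rw [norm_sq_E4]
  ext <;> simp [eta] <;> ring

lemma toQuat_mul_star_e (l : Fin 4) (x : E4) : toQuat x * star (toQuat (e l)) =
    (toQuat x * star (toQuat (e l))).im + x l • (1 : H) := by
  fin_cases l <;> ext <;> simp [e_apply]

lemma re_conj_toQuat (x : E4) (p : H) :
    (toQuat x * p * star (toQuat x)).re = ‖x‖ ^ 2 * p.re := by
  rw [norm_sq_E4]; simp; ring

lemma contDiff_toQuat : ContDiff ℝ ∞ toQuat := toQuatL.contDiff

/-- The linear map `x ↦ x̄`. -/
def starToQuatL : E4 →L[ℝ] H := LinearMap.toContinuousLinearMap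
  { toFun := fun x => star (toQuat x)
    map_add' := fun x y => by ext <;> simp <;> ring
    map_smul' := fun c x => by ext <;> simp }

lemma starToQuatL_apply (x : E4) : starToQuatL x = star (toQuat x) := rfl

lemma contDiff_star_toQuat : ContDiff ℝ ∞ fun x => star (toQuat x) := starToQuatL.contDiff

/-- The linear map `x ↦ Im (x ē_l)`. -/
def sdL (l : Fin 4) : E4 →L[ℝ] H := LinearMap.toContinuousLinearMap
  { toFun := fun x => (toQuat x * star (toQuat (e l))).im
    map_add' := fun x y => by ext <;> simp <;> ring
    map_smul' := fun c x => by ext <;> simp <;> ring }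

lemma contDiff_normSq : ContDiff ℝ ∞ fun x : E4 => ‖x‖ ^ 2 := contDiff_norm_sq ℝ

/-- The degree-one gauge transformation `x̄ / |x|`. -/
def invMap (x : E4) : H := ‖x‖⁻¹ • star (toQuat x)

lemma norm_invMap {x : E4} (hx : x ≠ 0) : ‖invMap x‖ = 1 := by
  have : ‖x‖ ≠ 0 := norm_ne_zero_iff.mpr hx
  rw [invMap, norm_smul, Quaternion.norm_star, norm_toQuat, norm_inv, norm_norm]
  field_simp

lemma invMap_ne_zero {x : E4} (hx : x ≠ 0) : invMap x ≠ 0 := by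
  rw [← norm_ne_zero_iff, norm_invMap hx]; exact one_ne_zero

lemma inv_invMap {x : E4} (hx : x ≠ 0) : (invMap x)⁻¹ = ‖x‖⁻¹ • toQuat x := by
  have : ‖x‖ ≠ 0 := norm_ne_zero_iff.mpr hx
  refine (eq_inv_of_mul_eq_one_left ?_).symm
  rw [invMap, smul_mul_smul_comm, toQuat_mul_star_self, smul_smul]
  field_simp
  exact one_smul ℝ _

lemma contDiffAt_invMap {x : E4} (hx : x ≠ 0) : ContDiffAt ℝ ∞ invMap x :=
  ((contDiffAt_norm ℝ hx).inv (norm_ne_zero_iff.mpr hx)).smul contDiff_star_toQuat.contDiffAt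

lemma fderiv_invMap {x : E4} (hx : x ≠ 0) (l : Fin 4) :
    fderiv ℝ invMap x (e l) =
      ‖x‖⁻¹ • star (toQuat (e l)) - (x l / ‖x‖ ^ 3) • star (toQuat x) := by
  have ht : 0 < ‖x‖ := norm_pos_iff.mpr hx
  have h0 : invMap = fun y => (√(‖y‖ ^ 2))⁻¹ • star (toQuat y) := by
    funext y; rw [Real.sqrt_sq (norm_nonneg y), invMap]
  have h1 : HasDerivAt (fun t : ℝ => (√t)⁻¹) (-(1 / (2 * √(‖x‖ ^ 2))) / √(‖x‖ ^ 2) ^ 2) (‖x‖ ^ 2) :=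
    (Real.hasDerivAt_sqrt (by positivity)).inv (by positivity)
  have h2 := (hasFDerivAt_comp_normSq h1).smul
    starToQuatL.hasFDerivAt
  have h3 := congrArg (fun L => L (e l)) h2.fderiv
  rw [h0]
  refine h3.trans ?_
  simp only [Real.sqrt_sq ht.le]
  simp only [add_apply, smul_apply, ContinuousLinearMap.smulRight_apply, starToQuatL_apply,
    innerSL_apply_apply, inner_e, smul_eq_mul]
  rw [sub_eq_add_neg, ← neg_smul]
  congr 2
  field_simp

/-- The connection `A`, cut off near the origin. -/
def cutForm (T : ℝ) (A : OneForm) : OneForm := fun l x => innerCut T (‖x‖ ^ 2) • A l x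

/-- The superposition of the modified instanton and `A`, in the singular gauge. -/
def singForm (m S T : ℝ) (A : OneForm) : OneForm :=
  cutForm T A + radialForm (singProfile m S)

/-- The superposition of the modified instanton and `A`, in the gauge that is regular at the
origin. -/
def glue (m S T : ℝ) (A : OneForm) : OneForm := fun l x =>
  (denom m S (‖x‖ ^ 2))⁻¹ • (toQuat x * star (toQuat (e l))).im
    + (innerCut T (‖x‖ ^ 2) / ‖x‖ ^ 2) • (toQuat x * A l x * star (toQuat x))

variable {m S T : ℝ} {A : OneForm}

/-- Away from the origin, the glued connection is a gauge transform of the superposition in the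
singular gauge, because `1 / t - singProfile m S t = 1 / denom m S t`. -/
lemma glue_eq_gaugeAct (hm : 0 < m) (hS : 0 < S) {x : E4} (hx : x ≠ 0) (l : Fin 4) :
    glue m S T A l x = gaugeAct invMap (singForm m S T A) l x := by
  have hr : 0 < ‖x‖ := norm_pos_iff.mpr hx
  have hd := (denom_pos hm hS (sq_nonneg ‖x‖)).ne'
  have hdd : m * outerCut S (‖x‖ ^ 2) = denom m S (‖x‖ ^ 2) - ‖x‖ ^ 2 := by unfold denom; ring
  simp only [gaugeAct, inv_invMap hx, fderiv_invMap hx, glue, singForm, cutForm, radialForm,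
    Pi.add_apply]
  simp only [invMap, mul_add, add_mul, mul_sub, smul_mul_assoc, mul_smul_comm, mul_assoc, smul_smul,
    conj_eta, toQuat_mul_star_self, smul_neg]
  rw [singProfile, hdd]
  have e1 := toQuat_mul_star_e l x
  generalize (toQuat x * star (toQuat (e l))).im = p at *
  rw [e1]
  generalize toQuat x * (A l x * star (toQuat x)) = q
  generalize denom m S (‖x‖ ^ 2) = u at *
  match_scalars <;> field_simp <;> ring

lemma isConnection_cutForm (T : ℝ) (hA : IsConnection A) : IsConnection (cutForm T A) := fun l =>
  ⟨((contDiff_innerCut T).comp contDiff_normSq).smul (hA l).1, fun x => by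
    simp [cutForm, (hA l).2 x]⟩

lemma isConnection_glue (hm : 0 < m) (hS : 0 < S) (hT : 0 < T) (hA : IsConnection A) :
    IsConnection (glue m S T A) := by
  intro l
  constructor
  · have h1 : ContDiff ℝ ∞ fun x : E4 => innerCut T (‖x‖ ^ 2) / ‖x‖ ^ 2 := by
      rw [contDiff_iff_contDiffAt]
      intro x
      rcases eq_or_ne x 0 with rfl | hx
      · have h0 : (fun x : E4 => innerCut T (‖x‖ ^ 2) / ‖x‖ ^ 2) =ᶠ[𝓝 0] fun _ => 0 := by
          have hc : ContinuousAt (fun x : E4 => ‖x‖ ^ 2) 0 := by fun_prop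
          filter_upwards [hc.eventually_lt continuousAt_const (by simpa using hT)] with y hy
          rw [innerCut_eq_zero hT (le_of_lt hy), zero_div]
        exact contDiffAt_const.congr_of_eventuallyEq h0
      · exact ((contDiff_innerCut T).comp contDiff_normSq).contDiffAt.div
          contDiff_normSq.contDiffAt (by positivity)
    exact ((((contDiff_denom m S).comp contDiff_normSq).inv
        fun x => (denom_pos hm hS (sq_nonneg ‖x‖)).ne').smul (sdL l).contDiff).add
      (h1.smul ((contDiff_toQuat.mul (hA l).1).mul contDiff_star_toQuat))
  · intro x
    rw [glue, Quaternion.re_add, Quaternion.re_smul, Quaternion.re_smul, re_conj_toQuat, (hA l).2 x]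
    simp

lemma differentiableAt_radialForm_singProfile (hm : 0 < m) (hS : 0 < S) {x : E4} (hx : x ≠ 0)
    (l : Fin 4) : DifferentiableAt ℝ (radialForm (singProfile m S) l) x :=
  (hasFDerivAt_radialForm (hasDerivAt_singProfile hm hS (by positivity)) l).differentiableAt

lemma differentiableAt_singForm (hm : 0 < m) (hS : 0 < S) (hA : IsConnection A) {x : E4}
    (hx : x ≠ 0) (l : Fin 4) : DifferentiableAt ℝ (singForm m S T A l) x :=
  ((isConnection_cutForm T hA).differentiableAt x l).add
    (differentiableAt_radialForm_singProfile hm hS hx l)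

lemma curv_glue (hm : 0 < m) (hS : 0 < S) (hA : IsConnection A) {x : E4} (hx : x ≠ 0) :
    curv (glue m S T A) x = conjTwo (invMap x) (curv (singForm m S T A) x) := by
  rw [← curv_gaugeAct (contDiffAt_invMap hx) (invMap_ne_zero hx)
    (differentiableAt_singForm hm hS hA hx)]
  refine curv_congr ?_
  filter_upwards [isOpen_ne.mem_nhds hx] with y hy l using glue_eq_gaugeAct hm hS hy l

lemma glue_eq_SD (hm : 0 < m) (hS : 0 < S) (hT : 0 < T) (hTS : 2 * T ≤ S) {x : E4}
    (hx : ‖x‖ ^ 2 ≤ T) (l : Fin 4) : glue m S T A l x = SD (√m)⁻¹ l x := by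
  have h2 : denom m S (‖x‖ ^ 2) = ‖x‖ ^ 2 + m := by
    rw [denom, outerCut_eq_one hS (by linarith), mul_one]
  rw [glue, SD, innerCut_eq_zero hT hx, h2, zero_div, zero_smul, add_zero]
  congr 1
  rw [inv_pow, Real.sq_sqrt hm.le]
  field_simp
  ring

lemma singForm_eq (hS : 0 < S) (hT : 0 < T) (hTS : 2 * T ≤ S) {x : E4} (hx : S ≤ ‖x‖ ^ 2)
    (l : Fin 4) : singForm m S T A l x = A l x := by
  simp [singForm, cutForm, radialForm, singProfile, outerCut_eq_zero hS hx,
    innerCut_eq_one hT (hTS.trans hx)]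

lemma glue_eq_gaugeAct_of_le (hm : 0 < m) (hS : 0 < S) (hT : 0 < T) (hTS : 2 * T ≤ S) {x : E4}
    (hx : S ≤ ‖x‖ ^ 2) (l : Fin 4) : glue m S T A l x = gaugeAct invMap A l x := by
  have hx0 : x ≠ 0 := by rintro rfl; simp at hx; linarith
  rw [glue_eq_gaugeAct hm hS hx0, gaugeAct, singForm_eq hS hT hTS hx, gaugeAct]

end

/-! ### The Chern integral of the glued connection -/

section

variable {m S T : ℝ} {A : OneForm}

lemma eventually_lt_normSq {c : ℝ} {x : E4} (hx : c < ‖x‖ ^ 2) : ∀ᶠ y in 𝓝 x, c < ‖y‖ ^ 2 :=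
  contDiff_normSq.continuous.continuousAt.eventually (lt_mem_nhds hx)

lemma eventually_normSq_lt {c : ℝ} {x : E4} (hx : ‖x‖ ^ 2 < c) : ∀ᶠ y in 𝓝 x, ‖y‖ ^ 2 < c :=
  contDiff_normSq.continuous.continuousAt.eventually (gt_mem_nhds hx)

lemma lt_normSq_of_sqrt_lt {c : ℝ} {x : E4} (hx : √c < ‖x‖) : c < ‖x‖ ^ 2 :=
  (Real.sqrt_lt' ((Real.sqrt_nonneg c).trans_lt hx)).mp hx

lemma ne_zero_of_lt_normSq {x : E4} (hS : 0 < S) (hx : S < ‖x‖ ^ 2) : x ≠ 0 := by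
  rintro rfl; simp at hx; linarith

lemma curv_singForm_of_lt (hS : 0 < S) (hT : 0 < T) {x : E4} (hx : S < ‖x‖ ^ 2)
    (hx' : 2 * T < ‖x‖ ^ 2) : curv (singForm m S T A) x = curv A x := by
  refine curv_congr ?_
  filter_upwards [eventually_lt_normSq hx, eventually_lt_normSq hx'] with y h1 h2 l
  simp [singForm, cutForm, radialForm, singProfile, outerCut_eq_zero hS h1.le,
    innerCut_eq_one hT h2.le]

lemma twoNormSq_curv_glue_of_lt (hm : 0 < m) (hS : 0 < S) (hT : 0 < T) (hA : IsConnection A)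
    {x : E4} (hx : S < ‖x‖ ^ 2) (hx' : 2 * T < ‖x‖ ^ 2) :
    twoNormSq (curv (glue m S T A) x) = twoNormSq (curv A x) := by
  have h0 := ne_zero_of_lt_normSq hS hx
  rw [curv_glue hm hS hA h0, twoNormSq_conjTwo (invMap_ne_zero h0),
    curv_singForm_of_lt hS hT hx hx']

lemma finiteEnergy_glue (hm : 0 < m) (hS : 0 < S) (hT : 0 < T) (hA : IsConnection A)
    (hi : FiniteEnergy A) : FiniteEnergy (glue m S T A) := by
  refine finiteEnergy_of_eq_outside (R := √(max S (2 * T))) hA (isConnection_glue hm hS hT hA)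
    (fun x hx => ?_) hi
  have h := max_lt_iff.mp (lt_normSq_of_sqrt_lt hx)
  exact (twoNormSq_curv_glue_of_lt hm hS hT hA h.1 h.2).symm

lemma cutForm_eq_of_lt (hT : 0 < T) {x : E4} (hx : 2 * T < ‖x‖ ^ 2) (l : Fin 4) :
    cutForm T A l x = A l x := by
  rw [cutForm, innerCut_eq_one hT hx.le, one_smul]

lemma curv_cutForm_of_lt (hT : 0 < T) {x : E4} (hx : 2 * T < ‖x‖ ^ 2) :
    curv (cutForm T A) x = curv A x :=
  curv_congr ((eventually_lt_normSq hx).mono fun _ hy l => cutForm_eq_of_lt hT hy l)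

lemma finiteEnergy_cutForm (hT : 0 < T) (hA : IsConnection A) (hi : FiniteEnergy A) :
    FiniteEnergy (cutForm T A) :=
  finiteEnergy_of_eq_outside (R := √(2 * T)) hA (isConnection_cutForm T hA)
    (fun x hx => by rw [curv_cutForm_of_lt hT (lt_normSq_of_sqrt_lt hx)]) hi

lemma chern_cutForm (hT : 0 < T) (hA : IsConnection A) (hi : FiniteEnergy A) :
    chern (cutForm T A) = chern A :=
  chern_eq_of_eq_outside (R := √(2 * T)) hA (isConnection_cutForm T hA)
    (fun _ hx l => (cutForm_eq_of_lt hT (lt_normSq_of_sqrt_lt hx) l).symm) hi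

lemma curv_zero_form (x : E4) : curv (fun _ _ => 0) x = 0 := by
  funext l m; simp [curv]

lemma trWedge_zero : trWedge 0 = 0 := by simp [trWedge, qtr]

/-- When the instanton and the cut-off connection have disjoint supports, the Chern densities
add. -/
lemma trWedge_curv_singForm_of_le (hS : 0 < S) (hST : S < T) (x : E4) :
    trWedge (curv (singForm m S T A) x) =
      trWedge (curv (cutForm T A) x) + trWedge (curv (radialForm (singProfile m S)) x) := by
  have hT : 0 < T := hS.trans hST
  rcases lt_or_ge (‖x‖ ^ 2) T with h | h
  · have h1 : ∀ᶠ y in 𝓝 x, ∀ l, cutForm T A l y = 0 :=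
      (eventually_normSq_lt h).mono fun y hy l => by
        rw [cutForm, innerCut_eq_zero hT hy.le, zero_smul]
    have h2 : ∀ᶠ y in 𝓝 x, ∀ l, singForm m S T A l y = radialForm (singProfile m S) l y :=
      h1.mono fun _ hy l => by simp [singForm, hy l]
    rw [curv_congr h1, curv_congr h2, curv_zero_form, trWedge_zero, zero_add]
  · have h0 : ∀ᶠ y in 𝓝 x, S < ‖y‖ ^ 2 := eventually_lt_normSq (hST.trans_le h)
    have h1 : ∀ᶠ y in 𝓝 x, ∀ l, radialForm (singProfile m S) l y = 0 :=
      h0.mono fun y hy l => by simp [radialForm, singProfile, outerCut_eq_zero hS hy.le]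
    have h2 : ∀ᶠ y in 𝓝 x, ∀ l, singForm m S T A l y = cutForm T A l y :=
      h1.mono fun y hy l => by simp [singForm, hy l]
    rw [curv_congr h1, curv_congr h2, curv_zero_form, trWedge_zero, add_zero]

/-- Gluing in an instanton lowers the Chern integral by `8π²`. -/
lemma chern_glue (hm : 0 < m) (hS : 0 < S) (hT : 0 < T) (hA : IsConnection A)
    (hi : FiniteEnergy A) : chern (glue m S T A) = chern A - 8 * Real.pi ^ 2 := by
  have hT' : 0 < 2 * S := by positivity
  have hc := isConnection_glue hm hS hT' hA
  have hf := finiteEnergy_glue hm hS hT' hA hi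
  -- Only the behaviour near infinity matters, so `A` may be cut off beyond the instanton.
  have h1 : chern (glue m S T A) = chern (glue m S (2 * S) A) := by
    refine chern_eq_of_eq_outside (R := √(max (2 * (2 * S)) (2 * T))) hc
      (isConnection_glue hm hS hT hA) (fun x hx l => ?_) hf
    have h := max_lt_iff.mp (lt_normSq_of_sqrt_lt hx)
    simp only [glue, innerCut_eq_one hT' h.1.le, innerCut_eq_one hT h.2.le]
  have h2 : chern (glue m S (2 * S) A) - chern (cutForm (2 * S) A) = -(8 * Real.pi ^ 2) := by
    rw [← integral_trWedge_singProfile hm hS, chern, chern, ← integral_sub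
      (hc.integrable_trWedge hf) ((isConnection_cutForm _ hA).integrable_trWedge
        (finiteEnergy_cutForm hT' hA hi))]
    refine integral_congr_ae ?_
    filter_upwards [compl_mem_ae_iff.mpr (measure_singleton (0 : E4))] with x hx
    have hx0 : x ≠ 0 := hx
    rw [curv_glue hm hS hA hx0, trWedge_conjTwo (invMap_ne_zero hx0),
      trWedge_curv_singForm_of_le hS (by linarith)]
    ring
  rw [chern_cutForm hT' hA hi] at h2
  linarith

end

/-! ### Pointwise bounds for the anti-self-dual curvature -/

section

lemma norm_asdVec_le {α : TwoCovector} {B : ℝ} (h : ∀ l m, ‖α l m‖ ≤ B) (k : Fin 3) :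
    ‖asdVec α k‖ ≤ B := by
  have key : ∀ p q : H, ‖p‖ ≤ B → ‖q‖ ≤ B → ‖(1 / 2 : ℝ) • (p + q)‖ ≤ B := by
    intro p q hp hq
    rw [norm_smul, Real.norm_of_nonneg (by norm_num)]
    linarith [norm_add_le p q]
  fin_cases k
  · simpa [asdVec, sub_eq_add_neg] using key (α 0 1) (-α 2 3) (h _ _) (by simpa using h 2 3)
  · simpa [asdVec] using key (α 0 2) (α 1 3) (h _ _) (h _ _)
  · simpa [asdVec, sub_eq_add_neg] using key (α 0 3) (-α 1 2) (h _ _) (by simpa using h 1 2)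

lemma norm_comm_le {p q : H} {P Q : ℝ} (hp : ‖p‖ ≤ P) (hq : ‖q‖ ≤ Q) :
    ‖p * q - q * p‖ ≤ 2 * (P * Q) := by
  have h1 : ‖p * q‖ ≤ P * Q := by
    rw [norm_mul]; exact mul_le_mul hp hq (norm_nonneg _) ((norm_nonneg _).trans hp)
  have h2 : ‖q * p‖ ≤ P * Q := by
    rw [norm_mul, mul_comm]; exact mul_le_mul hp hq (norm_nonneg _) ((norm_nonneg _).trans hp)
  linarith [norm_sub_le (p * q) (q * p)]

lemma norm_mixed_le {A B : OneForm} {x : E4} {P Q : ℝ} (hA : ∀ l, ‖A l x‖ ≤ P)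
    (hB : ∀ l, ‖B l x‖ ≤ Q) (l m : Fin 4) : ‖mixed A B x l m‖ ≤ 4 * (P * Q) := by
  have h1 := norm_comm_le (hA l) (hB m)
  have h2 := norm_comm_le (hB l) (hA m)
  have h3 := norm_add_le (A l x * B m x - B m x * A l x) (B l x * A m x - A m x * B l x)
  rw [mixed]
  linarith

lemma norm_toQuat_e (l : Fin 4) : ‖toQuat (e l)‖ = 1 := by
  rw [norm_toQuat]; simp [e]

lemma norm_im_le (p : H) : ‖p.im‖ ≤ ‖p‖ := by
  rw [← sq_le_sq₀ (norm_nonneg _) (norm_nonneg _), norm_sq_eq, norm_sq_eq]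
  simp
  positivity

lemma norm_eta_le (l : Fin 4) (x : E4) : ‖eta l x‖ ≤ ‖x‖ := by
  refine (norm_im_le _).trans ?_
  rw [norm_mul, Quaternion.norm_star, norm_toQuat, norm_toQuat_e, mul_one]

/-- The pairing of the anti-self-dual part of `α` with `dx̄ ∧ dx`, up to a positive factor. -/
def pairing (α : TwoCovector) : ℝ := ∑ k, inner ℝ (asdVec α k) (unitIm k)

lemma norm_unitIm (k : Fin 3) : ‖unitIm k‖ = 1 := norm_toQuat_e _

/-- Adding `-h dx̄ ∧ dx / 2` changes the squared norm, to first order in `h`, by a negative multiple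
of the pairing; `E` is an error term. -/
lemma sum_norm_sub_smul_unitIm_add_sq_le {a E : Fin 3 → H} {h M ε : ℝ} (hh : 0 ≤ h)
    (ha : ∀ k, ‖a k‖ ≤ M) (hE : ∀ k, ‖E k‖ ≤ ε) :
    ∑ k, ‖a k + (-h) • unitIm k + E k‖ ^ 2 ≤
      ∑ k, ‖a k‖ ^ 2 - 2 * h * (∑ k, inner ℝ (a k) (unitIm k)) + 3 * h ^ 2
        + 3 * (ε * (2 * (M + h) + ε)) := by
  have hk : ∀ k, ‖a k + (-h) • unitIm k + E k‖ ^ 2 ≤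
      ‖a k‖ ^ 2 - 2 * h * inner ℝ (a k) (unitIm k) + h ^ 2 + ε * (2 * (M + h) + ε) := by
    intro k
    have hε := (norm_nonneg _).trans (hE k)
    have hM := (norm_nonneg _).trans (ha k)
    have e1 : ‖a k + (-h) • unitIm k‖ ^ 2 = ‖a k‖ ^ 2 - 2 * h * inner ℝ (a k) (unitIm k) + h ^ 2 := by
      rw [norm_add_sq_real, inner_smul_right, norm_smul, norm_unitIm, Real.norm_eq_abs, mul_one,
        sq_abs]
      ring
    have e2 : ‖a k + (-h) • unitIm k‖ ≤ M + h := by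
      refine (norm_add_le _ _).trans ?_
      rw [norm_smul, norm_unitIm, norm_neg, Real.norm_of_nonneg hh, mul_one]
      linarith [ha k]
    have e3 : inner ℝ (a k + (-h) • unitIm k) (E k) ≤ (M + h) * ε :=
      (real_inner_le_norm _ _).trans (mul_le_mul e2 (hE k) (norm_nonneg _) (by linarith))
    have e4 : ‖E k‖ ^ 2 ≤ ε ^ 2 := pow_le_pow_left₀ (norm_nonneg _) (hE k) 2
    rw [norm_add_sq_real, e1]
    nlinarith
  refine (Finset.sum_le_sum fun k _ => hk k).trans (le_of_eq ?_)
  simp only [Finset.sum_add_distrib, Finset.sum_sub_distrib, Finset.sum_const, ← Finset.mul_sum]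
  simp

/-- The derivative of the standard cutoff, placed on the transition region `1 / 2 ≤ s ≤ 1`. -/
def bump (s : ℝ) : ℝ := deriv Real.smoothTransition (2 - 2 * s)

lemma continuous_deriv_smoothTransition : Continuous (deriv Real.smoothTransition) :=
  (Real.smoothTransition.contDiff (n := 1)).continuous_deriv (by simp)

lemma continuous_bump : Continuous bump :=
  continuous_deriv_smoothTransition.comp (by fun_prop)

lemma bump_nonneg (s : ℝ) : 0 ≤ bump s := Real.smoothTransition.monotone.deriv_nonneg

lemma deriv_smoothTransition_of_neg {z : ℝ} (hz : z < 0) : deriv Real.smoothTransition z = 0 := by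
  have : Real.smoothTransition =ᶠ[𝓝 z] fun _ => 0 :=
    (gt_mem_nhds hz).mono fun s hs => Real.smoothTransition.zero_of_nonpos (le_of_lt hs)
  rw [this.deriv_eq, deriv_const]

lemma deriv_smoothTransition_of_one_lt {z : ℝ} (hz : 1 < z) :
    deriv Real.smoothTransition z = 0 := by
  have : Real.smoothTransition =ᶠ[𝓝 z] fun _ => 1 :=
    (lt_mem_nhds hz).mono fun s hs => Real.smoothTransition.one_of_one_le (le_of_lt hs)
  rw [this.deriv_eq, deriv_const]

lemma exists_deriv_smoothTransition_le :
    ∃ L : ℝ, 0 < L ∧ ∀ z, |deriv Real.smoothTransition z| ≤ L := by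
  obtain ⟨L, hL⟩ := (isCompact_Icc (a := (0 : ℝ)) (b := 1)).exists_bound_of_continuousOn
    continuous_deriv_smoothTransition.continuousOn
  refine ⟨max L 1, by positivity, fun z => ?_⟩
  rcases lt_or_ge z 0 with h | h
  · rw [deriv_smoothTransition_of_neg h]; simp
  rcases lt_or_ge 1 z with h' | h'
  · rw [deriv_smoothTransition_of_one_lt h']; simp
  exact (hL z ⟨h, h'⟩).trans (le_max_left _ _)

variable {m S T t : ℝ} {A : OneForm}

lemma deriv_outerCut_eq (S t : ℝ) : deriv (outerCut S) t = -(2 / S * bump (t / S)) := by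
  have h1 : HasDerivAt (fun t : ℝ => 2 - 2 * (t / S)) (-(2 * (1 / S))) t :=
    (((hasDerivAt_id t).div_const S).const_mul 2).const_sub 2
  have h2 : HasDerivAt Real.smoothTransition (bump (t / S)) (2 - 2 * (t / S)) :=
    ((Real.smoothTransition.contDiff (n := 1)).differentiable (by simp) _).hasDerivAt
  have h3 : HasDerivAt (outerCut S) _ t := h2.comp t h1
  rw [h3.deriv]
  ring

lemma hasDerivAt_innerCut (T t : ℝ) :
    HasDerivAt (innerCut T) (deriv Real.smoothTransition (t / T - 1) * (1 / T)) t := by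
  have h1 : HasDerivAt (fun t : ℝ => t / T - 1) (1 / T) t :=
    ((hasDerivAt_id t).div_const T).sub_const 1
  have h2 : HasDerivAt Real.smoothTransition (deriv Real.smoothTransition (t / T - 1)) (t / T - 1) :=
    ((Real.smoothTransition.contDiff (n := 1)).differentiable (by simp) _).hasDerivAt
  exact h2.comp t h1

lemma bump_eq_zero_of_lt (hS : 0 < S) (h : t < S / 2) : bump (t / S) = 0 := by
  refine deriv_smoothTransition_of_one_lt ?_
  have : t / S < 1 / 2 := by rw [div_lt_iff₀ hS]; linarith
  linarith

lemma bump_eq_zero_of_gt (hS : 0 < S) (h : S < t) : bump (t / S) = 0 := by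
  refine deriv_smoothTransition_of_neg ?_
  have : 1 < t / S := by rw [lt_div_iff₀ hS]; linarith
  linarith

lemma singProfile_nonneg (hm : 0 < m) (hS : 0 < S) (ht : 0 ≤ t) : 0 ≤ singProfile m S t :=
  div_nonneg (mul_nonneg hm.le (outerCut_nonneg S t))
    (mul_nonneg (denom_pos hm hS ht).le ht)

/-- This bounds the commutator of the instanton with a connection that vanishes at the origin. -/
lemma mul_singProfile_le_one (hm : 0 < m) (hS : 0 < S) (ht : 0 < t) :
    t * singProfile m S t ≤ 1 := by
  have hd := denom_pos hm hS ht.le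
  have : t * singProfile m S t = m * outerCut S t / denom m S t := by
    rw [singProfile]; field_simp
  rw [this, div_le_one hd, denom]
  linarith

lemma mul_singProfile_le (hm : 0 < m) (hS : 0 < S) (ht : 0 < t) :
    t * singProfile m S t ≤ m / t := by
  have hd := denom_pos hm hS ht.le
  have : t * singProfile m S t = m * outerCut S t / denom m S t := by
    rw [singProfile]; field_simp
  rw [this]
  exact div_le_div₀ hm.le (mul_le_of_le_one_right hm.le (outerCut_le_one S t)) ht (le_denom hm)

lemma norm_radialForm_singProfile_le (hm : 0 < m) (hS : 0 < S) (x : E4) (l : Fin 4) :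
    ‖radialForm (singProfile m S) l x‖ ≤ singProfile m S (‖x‖ ^ 2) * ‖x‖ := by
  have h := singProfile_nonneg hm hS (sq_nonneg ‖x‖)
  rw [radialForm, norm_smul, Real.norm_of_nonneg h]
  exact mul_le_mul_of_nonneg_left (norm_eta_le l x) h

lemma norm_mixed_radialForm_le (hm : 0 < m) (hS : 0 < S) {B : OneForm} {x : E4} {M : ℝ}
    (hB : ∀ l, ‖B l x‖ ≤ M * ‖x‖) (l n : Fin 4) :
    ‖mixed B (radialForm (singProfile m S)) x l n‖ ≤
      4 * M * (‖x‖ ^ 2 * singProfile m S (‖x‖ ^ 2)) := by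
  refine (norm_mixed_le hB (norm_radialForm_singProfile_le hm hS x) l n).trans (le_of_eq ?_)
  ring

lemma curv_cutForm (hA : IsConnection A) (T : ℝ) (x : E4) (l n : Fin 4) :
    curv (cutForm T A) x l n =
      innerCut T (‖x‖ ^ 2) • (fderiv ℝ (A n) x (e l) - fderiv ℝ (A l) x (e n))
      + ((deriv Real.smoothTransition (‖x‖ ^ 2 / T - 1) * (1 / T) * (2 * x l)) • A n x
        - (deriv Real.smoothTransition (‖x‖ ^ 2 / T - 1) * (1 / T) * (2 * x n)) • A l x)
      + innerCut T (‖x‖ ^ 2) ^ 2 • (A l x * A n x - A n x * A l x) := by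
  have hd : ∀ n l, fderiv ℝ (cutForm T A n) x (e l) = innerCut T (‖x‖ ^ 2) • fderiv ℝ (A n) x (e l)
      + (deriv Real.smoothTransition (‖x‖ ^ 2 / T - 1) * (1 / T) * (2 * x l)) • A n x := by
    intro n l
    have h := (hasFDerivAt_comp_normSq (hasDerivAt_innerCut T (‖x‖ ^ 2))).smul
      (hA.differentiableAt x n).hasFDerivAt
    refine (congrArg (fun L => L (e l)) h.fderiv).trans ?_
    simp only [add_apply, smul_apply, ContinuousLinearMap.smulRight_apply, innerSL_apply_apply,
      inner_e, smul_eq_mul]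
  simp only [curv, hd]
  simp only [cutForm, smul_mul_smul_comm]
  module

/-- Cutting off `A` in the core keeps the curvature bounded: the cutoff has slope of order
`T ^ (-1 / 2)` where `A` is of order `T ^ (1 / 2)`. -/
lemma norm_curv_cutForm_le (hA : IsConnection A) (hT : 0 < T) {L M : ℝ}
    (hL : ∀ z, |deriv Real.smoothTransition z| ≤ L) {x : E4} (hx : ‖x‖ ^ 2 ≤ 2 * T)
    (hx1 : ‖x‖ ≤ 1) (h0 : ∀ l, ‖A l x‖ ≤ M * ‖x‖) (h1 : ∀ l n, ‖fderiv ℝ (A l) x (e n)‖ ≤ M)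
    (l n : Fin 4) : ‖curv (cutForm T A) x l n‖ ≤ 2 * M + 8 * L * M + 2 * M ^ 2 := by
  have hM : 0 ≤ M := (norm_nonneg _).trans (h1 0 0)
  have hL0 : 0 ≤ L := (abs_nonneg _).trans (hL 0)
  have hx0 := norm_nonneg x
  have h0' : ∀ l, ‖A l x‖ ≤ M := fun l => (h0 l).trans (mul_le_of_le_one_right hM hx1)
  have hψ0 := innerCut_nonneg T (‖x‖ ^ 2)
  have hψ1 := innerCut_le_one T (‖x‖ ^ 2)
  have t1 : ‖innerCut T (‖x‖ ^ 2) • (fderiv ℝ (A n) x (e l) - fderiv ℝ (A l) x (e n))‖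
      ≤ 2 * M := by
    rw [norm_smul, Real.norm_of_nonneg hψ0]
    refine (mul_le_of_le_one_left (norm_nonneg _) hψ1).trans ?_
    linarith [norm_sub_le (fderiv ℝ (A n) x (e l)) (fderiv ℝ (A l) x (e n)), h1 n l, h1 l n]
  have t2 : ∀ l n, ‖(deriv Real.smoothTransition (‖x‖ ^ 2 / T - 1) * (1 / T) * (2 * x l)) • A n x‖
      ≤ 4 * L * M := by
    intro l n
    have hxl : |x l| ≤ ‖x‖ := by simpa using PiLp.norm_apply_le x l
    rw [norm_smul, Real.norm_eq_abs, abs_mul, abs_mul, abs_mul, abs_of_pos (one_div_pos.mpr hT),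
      abs_two]
    calc |deriv Real.smoothTransition (‖x‖ ^ 2 / T - 1)| * (1 / T) * (2 * |x l|) * ‖A n x‖
        ≤ L * (1 / T) * (2 * ‖x‖) * (M * ‖x‖) := by
          gcongr
          · exact hL _
          · exact h0 n
      _ = 2 * L * M * (‖x‖ ^ 2 / T) := by ring
      _ ≤ 2 * L * M * 2 := by
          gcongr
          rw [div_le_iff₀ hT]; exact hx
      _ = 4 * L * M := by ring
  have t3 : ‖innerCut T (‖x‖ ^ 2) ^ 2 • (A l x * A n x - A n x * A l x)‖ ≤ 2 * M ^ 2 := by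
    rw [norm_smul, Real.norm_of_nonneg (by positivity)]
    refine (mul_le_of_le_one_left (norm_nonneg _) (pow_le_one₀ hψ0 hψ1)).trans ?_
    rw [sq M]
    exact norm_comm_le (h0' l) (h0' n)
  rw [curv_cutForm hA]
  refine (norm_add₃_le).trans ?_
  have t4 := norm_sub_le
    ((deriv Real.smoothTransition (‖x‖ ^ 2 / T - 1) * (1 / T) * (2 * x l)) • A n x)
    ((deriv Real.smoothTransition (‖x‖ ^ 2 / T - 1) * (1 / T) * (2 * x n)) • A l x)
  linarith [t2 l n, t2 n l]

end

/-! ### The energy of the glued connection -/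

section

variable {m S T : ℝ} {A : OneForm}

lemma isAlt_curv_singForm (hm : 0 < m) (hS : 0 < S) (hA : IsConnection A) {x : E4}
    (hx : x ≠ 0) : IsAlt (curv (singForm m S T A) x) := by
  refine isAlt_curv (differentiableAt_singForm hm hS hA hx) (Eventually.of_forall fun y l => ?_)
  simp [singForm, cutForm, radialForm, eta, (hA l).2 y]

lemma twoNormSq_asdPart_curv_glue (hm : 0 < m) (hS : 0 < S) (hA : IsConnection A) {x : E4}
    (hx : x ≠ 0) : twoNormSq (asdPart (curv (glue m S T A) x)) =
      4 * ∑ k, ‖asdVec (curv (singForm m S T A) x) k‖ ^ 2 := by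
  have h0 := invMap_ne_zero hx
  rw [curv_glue hm hS hA hx,
    twoNormSq_asdPart (isAlt_conjTwo h0 (isAlt_curv_singForm hm hS hA hx))]
  simp only [asdVec_conjTwo, norm_conj h0]

lemma curv_singForm (hm : 0 < m) (hS : 0 < S) (hA : IsConnection A) {x : E4} (hx : x ≠ 0) :
    curv (singForm m S T A) x = curv (cutForm T A) x + curv (radialForm (singProfile m S)) x
      + mixed (cutForm T A) (radialForm (singProfile m S)) x :=
  curv_add ((isConnection_cutForm T hA).differentiableAt x)
    (differentiableAt_radialForm_singProfile hm hS hx)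

lemma norm_cutForm_le (T : ℝ) (A : OneForm) (l : Fin 4) (x : E4) :
    ‖cutForm T A l x‖ ≤ ‖A l x‖ := by
  rw [cutForm, norm_smul, Real.norm_of_nonneg (innerCut_nonneg _ _)]
  exact mul_le_of_le_one_left (norm_nonneg _) (innerCut_le_one _ _)

/-- Near the core of the instanton the anti-self-dual curvature stays bounded, since the
instanton contributes none of its own. -/
lemma twoNormSq_asdPart_curv_glue_le_inner (hm : 0 < m) (hS : 0 < S) (hA : IsConnection A)
    (hT : 0 < T) (hTS : 4 * T < S) {L M : ℝ}
    (hL : ∀ z, |deriv Real.smoothTransition z| ≤ L) {x : E4} (hx0 : x ≠ 0)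
    (hx : ‖x‖ ^ 2 ≤ 2 * T) (hx1 : ‖x‖ ≤ 1) (h0 : ∀ l, ‖A l x‖ ≤ M * ‖x‖)
    (h1 : ∀ l n, ‖fderiv ℝ (A l) x (e n)‖ ≤ M) :
    twoNormSq (asdPart (curv (glue m S T A) x)) ≤
      12 * (2 * M + 8 * L * M + 2 * M ^ 2 + 4 * M) ^ 2 := by
  have hM : 0 ≤ M := (norm_nonneg _).trans (h1 0 0)
  have ht : 0 < ‖x‖ ^ 2 := by positivity
  rw [twoNormSq_asdPart_curv_glue hm hS hA hx0, curv_singForm hm hS hA hx0]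
  have hk : ∀ k, ‖asdVec (curv (cutForm T A) x + curv (radialForm (singProfile m S)) x
      + mixed (cutForm T A) (radialForm (singProfile m S)) x) k‖
      ≤ 2 * M + 8 * L * M + 2 * M ^ 2 + 4 * M := by
    intro k
    rw [asdVec_add, asdVec_add, asdVec_curv_singProfile hm hS hx0,
      deriv_outerCut_eq_zero hS (by linarith)]
    simp only [mul_zero, zero_div, zero_smul, add_zero]
    refine (norm_add_le _ _).trans (add_le_add
      (norm_asdVec_le (norm_curv_cutForm_le hA hT hL hx hx1 h0 h1) k) (norm_asdVec_le ?_ k))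
    intro l n
    refine (norm_mixed_radialForm_le hm hS
      (fun l => (norm_cutForm_le T A l x).trans (h0 l)) l n).trans ?_
    exact mul_le_of_le_one_right (by positivity) (mul_singProfile_le_one hm hS ht)
  calc _ ≤ 4 * ∑ k : Fin 3, (2 * M + 8 * L * M + 2 * M ^ 2 + 4 * M) ^ 2 := by
        gcongr with k
        exact hk k
    _ = _ := by simp; ring

/-- Away from the core, the transition of the instanton to a pure gauge lowers the
anti-self-dual energy density. -/
lemma twoNormSq_asdPart_curv_glue_le_outer (hm : 0 < m) (hS : 0 < S) (hA : IsConnection A)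
    (hT : 0 < T) (hmT : m ≤ T) {L M κ : ℝ} (hκ : 0 < κ)
    (hL : ∀ z, |deriv Real.smoothTransition z| ≤ L) (hmS : 12 * m * L ≤ κ * S ^ 2) {x : E4}
    (hx : 2 * T < ‖x‖ ^ 2) (h0 : ∀ l, ‖A l x‖ ≤ M * ‖x‖)
    (h1 : ∀ l n, ‖curv A x l n‖ ≤ M) (h2 : κ ≤ pairing (curv A x)) :
    twoNormSq (asdPart (curv (glue m S T A) x)) ≤ twoNormSq (asdPart (curv A x))
      - 2 * κ * (m / S ^ 2) * bump (‖x‖ ^ 2 / S) + 24 * M * (4 * M + 2 * κ) * (m / T) := by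
  have hM : 0 ≤ M := (norm_nonneg _).trans (h1 0 0)
  have ht : 0 < ‖x‖ ^ 2 := by linarith
  have hx0 : x ≠ 0 := ne_zero_of_lt_normSq (by positivity) hx
  have hb := bump_nonneg (‖x‖ ^ 2 / S)
  set t := ‖x‖ ^ 2 with ht_def
  set h : ℝ := t * m * (2 / S * bump (t / S)) / denom m S t ^ 2 with hh_def
  have hd := denom_pos hm hS ht.le
  have hh : 0 ≤ h := by positivity
  -- `h` is comparable to `m / S²` on the transition region.
  have hlow : m / S ^ 2 * bump (t / S) ≤ 2 * h := by
    rcases lt_or_ge S t with hSt | hSt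
    · rw [bump_eq_zero_of_gt hS hSt] at hh_def ⊢
      simp [hh_def]
    have hu : denom m S t ≤ 2 * t := (denom_le hm).trans (by linarith)
    have e1 : m * (2 / S * bump (t / S)) / (4 * S) ≤ h := by
      rw [hh_def, div_le_div_iff₀ (by positivity) (by positivity)]
      have : denom m S t ^ 2 ≤ t * (4 * S) := by nlinarith
      calc m * (2 / S * bump (t / S)) * denom m S t ^ 2
          ≤ m * (2 / S * bump (t / S)) * (t * (4 * S)) := by gcongr
        _ = _ := by ring
    have e2 : m * (2 / S * bump (t / S)) / (4 * S) = (m / S ^ 2 * bump (t / S)) / 2 := by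
      field_simp; ring
    linarith
  -- `h` is so small that its square is dominated by the cross term.
  have hup : 3 * h ≤ κ := by
    rcases lt_or_ge t (S / 2) with hSt | hSt
    · rw [bump_eq_zero_of_lt hS hSt] at hh_def
      simp [hh_def, hκ.le]
    have e1 : h ≤ m * (2 / S * L) / (S / 2) := by
      rw [hh_def, div_le_div_iff₀ (by positivity) (by positivity)]
      have e3 : t ≤ denom m S t := le_denom hm
      have e4 : t * (S / 2) ≤ denom m S t ^ 2 := by nlinarith
      have e5 : bump (t / S) ≤ L := (le_abs_self _).trans (hL _)
      have hL0 : 0 ≤ L := hb.trans e5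
      calc t * m * (2 / S * bump (t / S)) * (S / 2)
          = m * (2 / S * bump (t / S)) * (t * (S / 2)) := by ring
        _ ≤ m * (2 / S * L) * denom m S t ^ 2 := by gcongr
    have e2 : m * (2 / S * L) / (S / 2) = 4 * m * L / S ^ 2 := by field_simp; ring
    have e3 : 4 * m * L / S ^ 2 ≤ κ / 3 := by
      rw [div_le_div_iff₀ (by positivity) (by positivity)]; linarith
    linarith
  have hcut : curv (cutForm T A) x = curv A x := curv_cutForm_of_lt hT hx
  set ε : ℝ := 2 * M * (m / T) with hε
  have hE : ∀ k, ‖asdVec (mixed (cutForm T A) (radialForm (singProfile m S)) x) k‖ ≤ ε := by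
    refine norm_asdVec_le fun l n => ?_
    refine (norm_mixed_radialForm_le hm hS
      (fun l => (norm_cutForm_le T A l x).trans (h0 l)) l n).trans ?_
    have e1 := mul_singProfile_le hm hS ht
    have e2 : m / t ≤ m / (2 * T) := by gcongr
    have e3 : m / (2 * T) = m / T / 2 := by field_simp
    calc 4 * M * (‖x‖ ^ 2 * singProfile m S (‖x‖ ^ 2)) ≤ 4 * M * (m / T / 2) := by
          gcongr; linarith
      _ = ε := by rw [hε]; ring
  have hsum := sum_norm_sub_smul_unitIm_add_sq_le hh (norm_asdVec_le h1) hE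
  have hmT' : m / T ≤ 1 := (div_le_one hT).mpr hmT
  have hmT0 : 0 ≤ m / T := by positivity
  have hε1 : ε ≤ 2 * M := by
    rw [hε]; exact mul_le_of_le_one_right (by positivity) hmT'
  have herr : ε * (2 * (M + h) + ε) ≤ 2 * M * (4 * M + 2 * κ) * (m / T) := by
    calc ε * (2 * (M + h) + ε) ≤ ε * (4 * M + 2 * κ) := by
          refine mul_le_mul_of_nonneg_left ?_ (by positivity)
          linarith
      _ = _ := by rw [hε]; ring
  have hF : ∀ k, asdVec (curv (singForm m S T A) x) k = asdVec (curv A x) k + (-h) • unitIm k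
      + asdVec (mixed (cutForm T A) (radialForm (singProfile m S)) x) k := by
    intro k
    rw [curv_singForm hm hS hA hx0, hcut, asdVec_add, asdVec_add,
      asdVec_curv_singProfile hm hS hx0, deriv_outerCut_eq]
    congr 3
    rw [hh_def]; ring
  rw [twoNormSq_asdPart_curv_glue hm hS hA hx0, twoNormSq_asdPart (hA.isAlt_curv x)]
  simp only [hF]
  have hgain : κ * h ≤ 2 * h * pairing (curv A x) - 3 * h ^ 2 := by nlinarith
  have hgain2 : κ * (m / S ^ 2 * bump (t / S)) ≤ 2 * (κ * h) := by nlinarith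
  rw [pairing] at hgain
  nlinarith

lemma integral_bump_pos : 0 < ∫ y : E4, bump (‖y‖ ^ 2) := by
  have hc : Continuous fun y : E4 => bump (‖y‖ ^ 2) := continuous_bump.comp (by fun_prop)
  obtain ⟨z, hz⟩ : ∃ z, deriv Real.smoothTransition z ≠ 0 := by
    by_contra! h
    have h1 := is_const_of_deriv_eq_zero
      ((Real.smoothTransition.contDiff (n := 1)).differentiable (by simp)) h 0 1
    rw [Real.smoothTransition.zero, Real.smoothTransition.one] at h1
    exact zero_ne_one h1
  have hz1 : z ≤ 1 := by
    by_contra! h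
    exact hz (deriv_smoothTransition_of_one_lt h)
  refine hc.integral_pos_of_hasCompactSupport_nonneg_nonzero (x := √(1 - z / 2) • e 0)
    (hasCompactSupport_of_eq_zero (R := 1) fun x hx => ?_) (fun y => bump_nonneg _) ?_
  · have := bump_eq_zero_of_gt one_pos (t := ‖x‖ ^ 2) (by nlinarith)
    simpa using this
  · have h2 : ‖√(1 - z / 2) • e 0‖ ^ 2 = 1 - z / 2 := by
      rw [norm_smul, ← norm_toQuat (e 0), norm_toQuat_e, mul_one, Real.norm_eq_abs, sq_abs,
        Real.sq_sqrt (by linarith)]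
    rw [h2, bump]
    convert hz using 2
    ring

lemma integral_bump_div (hS : 0 < S) :
    ∫ x : E4, bump (‖x‖ ^ 2 / S) = S ^ 2 * ∫ y : E4, bump (‖y‖ ^ 2) := by
  have h := Measure.integral_comp_smul (volume : Measure E4) (fun y => bump (‖y‖ ^ 2)) (√S)⁻¹
  have e1 : ∀ x : E4, ‖(√S)⁻¹ • x‖ ^ 2 = ‖x‖ ^ 2 / S := by
    intro x
    rw [norm_smul, mul_pow, norm_inv, inv_pow, Real.norm_eq_abs, sq_abs, Real.sq_sqrt hS.le]
    field_simp
  simp only [e1] at h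
  rw [h]
  have e2 : ((√S)⁻¹ ^ 4)⁻¹ = S ^ 2 := by
    rw [inv_pow, inv_inv, show (√S) ^ 4 = (√S ^ 2) ^ 2 by ring, Real.sq_sqrt hS.le]
  simp only [finrank_euclideanSpace, Fintype.card_fin, smul_eq_mul, e2]
  rw [abs_of_pos (by positivity)]

lemma volume_real_closedBall_sqrt (hS : 0 ≤ S) :
    (volume : Measure E4).real (Metric.closedBall 0 (√S)) = Real.pi ^ 2 / 2 * S ^ 2 := by
  rw [Measure.real, InnerProductSpace.volume_closedBall_of_dim_even (k := 2) (by simp)]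
  rw [finrank_euclideanSpace, Fintype.card_fin, ENNReal.toReal_mul, ENNReal.toReal_pow,
    ENNReal.toReal_ofReal (Real.sqrt_nonneg S), ENNReal.toReal_ofReal (by positivity),
    show (√S) ^ 4 = (√S ^ 2) ^ 2 by ring, Real.sq_sqrt hS]
  simp
  ring

end

section

variable {m S T : ℝ} {A : OneForm}

lemma norm_e (l : Fin 4) : ‖e l‖ = 1 := by simp [e]

lemma IsConnection.exists_bound (hA : IsConnection A) (h0 : ∀ l, A l 0 = 0) :
    ∃ M : ℝ, ∀ x : E4, ‖x‖ ≤ 1 → (∀ l, ‖A l x‖ ≤ M * ‖x‖) ∧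
      (∀ l n, ‖fderiv ℝ (A l) x (e n)‖ ≤ M) ∧ ∀ l n, ‖curv A x l n‖ ≤ M := by
  have hc1 : Continuous fun x => fun l => fderiv ℝ (A l) x :=
    continuous_pi fun l => (hA l).1.continuous_fderiv (by simp)
  have hc2 : Continuous fun x => curv A x :=
    continuous_pi fun l => continuous_pi fun n => hA.continuous_curv l n
  obtain ⟨M₁, hM₁⟩ := (isCompact_closedBall (0 : E4) 1).exists_bound_of_continuousOn
    (f := fun x => fun l => fderiv ℝ (A l) x) hc1.continuousOn
  obtain ⟨M₂, hM₂⟩ := (isCompact_closedBall (0 : E4) 1).exists_bound_of_continuousOn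
    (f := fun x => curv A x) hc2.continuousOn
  have hd : ∀ x ∈ Metric.closedBall (0 : E4) 1, ∀ l, ‖fderiv ℝ (A l) x‖ ≤ M₁ := fun x hx l =>
    (norm_le_pi_norm (fun l => fderiv ℝ (A l) x) l).trans (hM₁ x hx)
  refine ⟨max M₁ M₂, fun x hx => ?_⟩
  have hx' : x ∈ Metric.closedBall (0 : E4) 1 := by simpa using hx
  refine ⟨fun l => ?_, fun l n => ?_, fun l n => ?_⟩
  · have h := (convex_closedBall (0 : E4) 1).norm_image_sub_le_of_norm_fderiv_le
      (fun y _ => hA.differentiableAt y l) (fun y hy => hd y hy l)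
      (Metric.mem_closedBall_self zero_le_one) hx'
    rw [h0, sub_zero, sub_zero] at h
    exact h.trans (mul_le_mul_of_nonneg_right (le_max_left _ _) (norm_nonneg _))
  · refine ((fderiv ℝ (A l) x).le_opNorm (e n)).trans ?_
    rw [norm_e, mul_one]
    exact (hd x hx' l).trans (le_max_left _ _)
  · exact ((norm_le_pi_norm (curv A x l) n).trans
      ((norm_le_pi_norm (curv A x) l).trans (hM₂ x hx'))).trans (le_max_right _ _)

lemma IsConnection.continuous_pairing (hA : IsConnection A) :
    Continuous fun x => pairing (curv A x) :=
  continuous_finsetSum _ fun k _ => (hA.continuous_asdVec k).inner continuous_const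

/-- Gluing in an instanton of size `√m` costs `8π²` and, when the pairing at the origin is
positive, gains an energy of order `m`; the errors come from cutting off `A` in the core and from
the commutators of `A` with the instanton. -/
lemma YM_glue_le (hA : IsConnection A) (hi : FiniteEnergy A) (h0 : ∀ l, A l 0 = 0)
    (hp : 0 < pairing (curv A 0)) :
    ∃ c C s₀ k : ℝ, 0 < c ∧ 0 < s₀ ∧ 0 < k ∧ ∀ m S T : ℝ, 0 < m → 0 < S → 0 < T → 4 * T < S →
      m ≤ T → m ≤ k * S ^ 2 → S ≤ s₀ →
      YM (glue m S T A) ≤ YM A + 8 * Real.pi ^ 2 - c * m + C * (m / T * S ^ 2 + T ^ 2) := by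
  obtain ⟨M, hM⟩ := hA.exists_bound h0
  obtain ⟨L, hL0, hL⟩ := exists_deriv_smoothTransition_le
  have hM0 : 0 ≤ M := (norm_nonneg _).trans ((hM 0 (by simp)).2.2 0 0)
  set κ := pairing (curv A 0) / 2 with hκ_def
  have hκ : 0 < κ := half_pos hp
  obtain ⟨r, hr, hball⟩ := Metric.eventually_nhds_iff.mp
    (hA.continuous_pairing.continuousAt.eventually (lt_mem_nhds (half_lt_self hp)))
  set β := ∫ y : E4, bump (‖y‖ ^ 2) with hβ
  have hβ0 : 0 < β := integral_bump_pos
  set K₁ := 24 * M * (4 * M + 2 * κ) with hK₁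
  set K₂ := 12 * (2 * M + 8 * L * M + 2 * M ^ 2 + 4 * M) ^ 2 with hK₂
  have hK₁0 : 0 ≤ K₁ := by positivity
  have hK₂0 : 0 ≤ K₂ := by positivity
  refine ⟨4 * κ * β, Real.pi ^ 2 * (K₁ + 4 * K₂), min 1 (r ^ 2 / 4), κ / (12 * L),
    by positivity, by positivity, by positivity, ?_⟩
  intro m S T hm hS hT hTS hmT hmS hSs
  have hG := isConnection_glue hm hS hT hA
  have hGi := finiteEnergy_glue hm hS hT hA hi
  have hmS' : 12 * m * L ≤ κ * S ^ 2 := by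
    rw [div_mul_eq_mul_div, le_div_iff₀ (by positivity)] at hmS
    linarith
  have hsmall : ∀ x : E4, ‖x‖ ^ 2 ≤ S → ‖x‖ ≤ 1 ∧ κ ≤ pairing (curv A x) := by
    intro x hx
    have h1 : ‖x‖ ^ 2 ≤ 1 := hx.trans (hSs.trans (min_le_left _ _))
    have h2 : ‖x‖ ^ 2 ≤ r ^ 2 / 4 := hx.trans (hSs.trans (min_le_right _ _))
    refine ⟨by nlinarith [norm_nonneg x], (hball ?_).le⟩
    rw [dist_zero_right]
    nlinarith [norm_nonneg x]
  set f : E4 → ℝ := fun x => twoNormSq (asdPart (curv (glue m S T A) x))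
    - twoNormSq (asdPart (curv A x)) with hf
  set b : E4 → ℝ := fun x => bump (‖x‖ ^ 2 / S) with hb
  set i₁ : E4 → ℝ := (Metric.closedBall (0 : E4) (√S)).indicator fun _ => K₁ * (m / T) with hi₁
  set i₂ : E4 → ℝ := (Metric.closedBall (0 : E4) (√(2 * T))).indicator fun _ => K₂ with hi₂
  have hi₁0 : ∀ x, 0 ≤ i₁ x := fun x => Set.indicator_nonneg (fun _ _ => by positivity) x
  have hi₂0 : ∀ x, 0 ≤ i₂ x := fun x => Set.indicator_nonneg (fun _ _ => by positivity) x
  have hmem : ∀ (x : E4) (c : ℝ), 0 ≤ c → ‖x‖ ^ 2 ≤ c → x ∈ Metric.closedBall (0 : E4) (√c) := by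
    intro x c _ hx
    rw [mem_closedBall_zero_iff]
    exact Real.le_sqrt_of_sq_le hx
  have hpt : ∀ x : E4, x ≠ 0 → f x ≤ (-(2 * κ * (m / S ^ 2)) * b x + i₁ x) + i₂ x := by
    intro x hx
    rcases le_or_gt (‖x‖ ^ 2) (2 * T) with h | h
    · obtain ⟨hx1, -⟩ := hsmall x (by linarith)
      obtain ⟨b1, b2, -⟩ := hM x hx1
      have h1 := twoNormSq_asdPart_curv_glue_le_inner hm hS hA hT hTS hL hx h hx1 b1 b2
      have h2 : b x = 0 := bump_eq_zero_of_lt hS (by linarith)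
      have h3 : i₂ x = K₂ := Set.indicator_of_mem (hmem x _ (by positivity) h) _
      have h4 := hi₁0 x
      have h5 := twoNormSq_nonneg (asdPart (curv A x))
      rw [h2, h3, hf]
      linarith
    rcases le_or_gt (‖x‖ ^ 2) S with h' | h'
    · obtain ⟨hx1, hx2⟩ := hsmall x h'
      obtain ⟨b1, -, b3⟩ := hM x hx1
      have h1 := twoNormSq_asdPart_curv_glue_le_outer hm hS hA hT hmT hκ hL hmS' h b1 b3 hx2
      have h3 : i₁ x = K₁ * (m / T) := Set.indicator_of_mem (hmem x _ hS.le h') _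
      have h4 := hi₂0 x
      rw [h3]
      simp only [hf, hb]
      linarith
    · have h1 : f x = 0 := by
        have h0 := invMap_ne_zero hx
        simp only [hf]
        rw [curv_glue hm hS hA hx, curv_singForm_of_lt hS hT h' h,
          twoNormSq_asdPart (isAlt_conjTwo h0 (hA.isAlt_curv x)),
          twoNormSq_asdPart (hA.isAlt_curv x)]
        simp only [asdVec_conjTwo, norm_conj h0, sub_self]
      have h2 : b x = 0 := bump_eq_zero_of_gt hS h'
      rw [h1, h2]
      linarith [hi₁0 x, hi₂0 x]
  have hfi : Integrable f :=
    (hG.integrable_twoNormSq_asdPart hGi).sub (hA.integrable_twoNormSq_asdPart hi)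
  have hbi : Integrable b := by
    have hc : Continuous b := continuous_bump.comp (by fun_prop)
    exact hc.integrable_of_hasCompactSupport (hasCompactSupport_of_eq_zero (R := √S)
      fun x hx => bump_eq_zero_of_gt hS (lt_normSq_of_sqrt_lt hx))
  have hb1 : Integrable fun x => -(2 * κ * (m / S ^ 2)) * b x := hbi.const_mul _
  have hint : ∀ (R K : ℝ), Integrable ((Metric.closedBall (0 : E4) R).indicator fun _ => K) :=
    fun R K => (integrable_indicator_iff Metric.isClosed_closedBall.measurableSet).mpr
      (integrableOn_const (isCompact_closedBall (0 : E4) R).measure_lt_top.ne)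
  have hle : ∫ x, f x ≤ ∫ x, ((-(2 * κ * (m / S ^ 2)) * b x + i₁ x) + i₂ x) := by
    refine integral_mono_ae hfi ((hb1.add (hint _ _)).add (hint _ _)) ?_
    filter_upwards [compl_mem_ae_iff.mpr (measure_singleton (0 : E4))] with x hx
    exact hpt x hx
  have hb1i : Integrable fun x => -(2 * κ * (m / S ^ 2)) * b x + i₁ x := hb1.add (hint _ _)
  rw [integral_add hb1i (hint _ _), integral_add hb1 (hint _ _), integral_const_mul,
    integral_bump_div hS, integral_indicator_const _ Metric.isClosed_closedBall.measurableSet,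
    integral_indicator_const _ Metric.isClosed_closedBall.measurableSet,
    volume_real_closedBall_sqrt hS.le, volume_real_closedBall_sqrt (by positivity)] at hle
  have hfs : ∫ x, f x = (∫ x, twoNormSq (asdPart (curv (glue m S T A) x)))
      - ∫ x, twoNormSq (asdPart (curv A x)) :=
    integral_sub (hG.integrable_twoNormSq_asdPart hGi) (hA.integrable_twoNormSq_asdPart hi)
  rw [YM_eq hG hGi, YM_eq hA hi, chern_glue hm hS hT hA hi]
  have e1 : -(2 * κ * (m / S ^ 2)) * (S ^ 2 * β) = -(2 * κ * β * m) := by field_simp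
  rw [e1, hfs] at hle
  simp only [smul_eq_mul] at hle
  have p1 : 0 ≤ Real.pi ^ 2 * K₁ * T ^ 2 := by positivity
  have p2 : 0 ≤ Real.pi ^ 2 * K₂ * (m / T * S ^ 2) := by positivity
  linarith

end

/-! ### Global gauge transformations -/

section

variable {A : OneForm}

lemma inv_eq_star_of_norm_eq_one {p : H} (hp : ‖p‖ = 1) : p⁻¹ = star p := by
  refine (eq_inv_of_mul_eq_one_left ?_).symm
  rw [Quaternion.star_mul_self, Quaternion.normSq_eq_norm_mul_self, hp]
  simp

lemma ne_zero_of_norm_eq_one {p : H} (hp : ‖p‖ = 1) : p ≠ 0 := by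
  rw [← norm_ne_zero_iff, hp]; exact one_ne_zero

/-- Quaternionic conjugation as a continuous linear map. -/
def starCLM : H →L[ℝ] H := LinearMap.toContinuousLinearMap
  { toFun := star
    map_add' := star_add
    map_smul' := fun c x => by ext <;> simp }

lemma re_star_mul_fderiv {g : E4 → H} (hg : ContDiff ℝ ∞ g) (hu : ∀ x, ‖g x‖ = 1) (x v : E4) :
    (star (g x) * fderiv ℝ g x v).re = 0 := by
  have h1 := (hg.differentiable (by simp) x).hasFDerivAt.norm_sq
  have h2 : (fun y => ‖g y‖ ^ 2) = fun _ => (1 : ℝ) := by funext y; rw [hu, one_pow]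
  rw [h2] at h1
  have h3 := congrArg (fun L => L v) (h1.unique (hasFDerivAt_const (1 : ℝ) x))
  have h4 : inner ℝ (g x) (fderiv ℝ g x v) = 0 := by simpa using h3
  rw [Quaternion.inner_def] at h4
  simp at h4 ⊢
  linarith

lemma isConnection_gaugeAct {g : E4 → H} (hg : ContDiff ℝ ∞ g) (hu : ∀ x, ‖g x‖ = 1)
    (hA : IsConnection A) : IsConnection (gaugeAct g A) := by
  have hinv : ∀ x, (g x)⁻¹ = star (g x) := fun x => inv_eq_star_of_norm_eq_one (hu x)
  intro l
  constructor
  · have h1 : ContDiff ℝ ∞ fun x => star (g x) := starCLM.contDiff.comp hg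
    have h2 : ContDiff ℝ ∞ fun x => fderiv ℝ g x (e l) :=
      (hg.fderiv_right (m := ∞) (by simp)).clm_apply contDiff_const
    have h3 : gaugeAct g A l = fun x => star (g x) * A l x * g x
        + star (g x) * fderiv ℝ g x (e l) := by funext x; rw [gaugeAct, hinv]
    rw [h3]
    exact ((h1.mul (hA l).1).mul hg).add (h1.mul h2)
  · intro x
    have h1 := qtr_conj (ne_zero_of_norm_eq_one (hu x)) (A l x)
    simp only [qtr, (hA l).2 x, mul_zero, mul_eq_zero, OfNat.ofNat_ne_zero, false_or] at h1
    rw [gaugeAct, Quaternion.re_add, h1, hinv, re_star_mul_fderiv hg hu, add_zero]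

lemma gaugeAct_gaugeAct {g h : E4 → H} {x : E4} (hg : DifferentiableAt ℝ g x)
    (hh : DifferentiableAt ℝ h x) (hx : g x ≠ 0) (l : Fin 4) :
    gaugeAct h (gaugeAct g A) l x = gaugeAct (fun y => g y * h y) A l x := by
  have hm : (g x * h x)⁻¹ = (h x)⁻¹ * (g x)⁻¹ := mul_inv_rev _ _
  simp only [gaugeAct, fderiv_mul_apply hg hh, hm]
  simp only [mul_add, add_mul, mul_assoc, inv_mul_cancel_left₀ hx, add_assoc]

lemma curv_gaugeAct_global {g : E4 → H} (hg : ContDiff ℝ ∞ g) (hu : ∀ x, ‖g x‖ = 1)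
    (hA : IsConnection A) (x : E4) :
    curv (gaugeAct g A) x = conjTwo (g x) (curv A x) :=
  curv_gaugeAct hg.contDiffAt (ne_zero_of_norm_eq_one (hu x)) (hA.differentiableAt x)

lemma twoNormSq_curv_gaugeAct {g : E4 → H} (hg : ContDiff ℝ ∞ g) (hu : ∀ x, ‖g x‖ = 1)
    (hA : IsConnection A) (x : E4) :
    twoNormSq (curv (gaugeAct g A) x) = twoNormSq (curv A x) := by
  rw [curv_gaugeAct_global hg hu hA, twoNormSq_conjTwo (ne_zero_of_norm_eq_one (hu x))]

lemma YM_gaugeAct {g : E4 → H} (hg : ContDiff ℝ ∞ g) (hu : ∀ x, ‖g x‖ = 1)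
    (hA : IsConnection A) : YM (gaugeAct g A) = YM A := by
  simp only [YM, twoNormSq_curv_gaugeAct hg hu hA]

lemma finiteEnergy_gaugeAct {g : E4 → H} (hg : ContDiff ℝ ∞ g) (hu : ∀ x, ‖g x‖ = 1)
    (hA : IsConnection A) (hi : FiniteEnergy A) : FiniteEnergy (gaugeAct g A) := by
  simpa only [FiniteEnergy, twoNormSq_curv_gaugeAct hg hu hA] using hi

lemma chern_gaugeAct {g : E4 → H} (hg : ContDiff ℝ ∞ g) (hu : ∀ x, ‖g x‖ = 1)
    (hA : IsConnection A) : chern (gaugeAct g A) = chern A := by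
  have h : ∀ x, trWedge (curv (gaugeAct g A) x) = trWedge (curv A x) := fun x => by
    rw [curv_gaugeAct_global hg hu hA, trWedge_conjTwo (ne_zero_of_norm_eq_one (hu x))]
  simp only [chern, h]

/-- The linear map `x ↦ ∑ x_l p_l`. -/
def linComb (p : Fin 4 → H) : E4 →L[ℝ] H := LinearMap.toContinuousLinearMap
  { toFun := fun x => ∑ l, x l • p l
    map_add' := fun x y => by simp [add_smul, Finset.sum_add_distrib]
    map_smul' := fun c x => by simp [mul_smul, Finset.smul_sum] }

lemma linComb_apply (p : Fin 4 → H) (x : E4) : linComb p x = ∑ l, x l • p l := rfl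

lemma linComb_e (p : Fin 4 → H) (l : Fin 4) : linComb p (e l) = p l := by
  simp [linComb_apply, e_apply]

lemma re_linComb {p : Fin 4 → H} (hp : ∀ l, (p l).re = 0) (x : E4) : (linComb p x).re = 0 := by
  simp [linComb_apply, Fin.sum_univ_four, hp]

lemma norm_one_sub_sq {p : H} (hp : p.re = 0) : ‖1 - p‖ ^ 2 = 1 + ‖p‖ ^ 2 := by
  simp [norm_sq_eq, hp]; ring

/-- A gauge transformation with value `q` at the origin that makes the connection with value `p`
at the origin vanish there: the projection of `(1 - ∑ x_l p_l) q` to the unit sphere. -/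
def centerGauge (p : Fin 4 → H) (q : H) (x : E4) : H :=
  (√(1 + ‖linComb p x‖ ^ 2))⁻¹ • ((1 - linComb p x) * q)

lemma contDiff_centerGauge (p : Fin 4 → H) (q : H) : ContDiff ℝ ∞ (centerGauge p q) := by
  have h1 : ContDiff ℝ ∞ fun x => 1 + ‖linComb p x‖ ^ 2 :=
    contDiff_const.add ((linComb p).contDiff.norm_sq ℝ)
  have h2 : ∀ x, 1 + ‖linComb p x‖ ^ 2 ≠ 0 := fun x => by positivity
  exact ((h1.sqrt h2).inv fun x => by positivity).smul
    ((contDiff_const.sub (linComb p).contDiff).mul contDiff_const)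

lemma norm_centerGauge {p : Fin 4 → H} {q : H} (hp : ∀ l, (p l).re = 0) (hq : ‖q‖ = 1) (x : E4) :
    ‖centerGauge p q x‖ = 1 := by
  have h : ‖1 - linComb p x‖ = √(1 + ‖linComb p x‖ ^ 2) := by
    rw [← norm_one_sub_sq (re_linComb hp x), Real.sqrt_sq (norm_nonneg _)]
  have h2 : 0 < √(1 + ‖linComb p x‖ ^ 2) := by positivity
  rw [centerGauge, norm_smul, norm_mul, hq, h, mul_one, norm_inv, Real.norm_of_nonneg h2.le,
    inv_mul_cancel₀ h2.ne']

lemma centerGauge_zero (p : Fin 4 → H) (q : H) : centerGauge p q 0 = q := by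
  simp [centerGauge]

lemma fderiv_centerGauge_zero (p : Fin 4 → H) (q : H) (l : Fin 4) :
    fderiv ℝ (centerGauge p q) 0 (e l) = -(p l * q) := by
  have h1 : HasFDerivAt (fun x => ‖linComb p x‖ ^ 2) (0 : E4 →L[ℝ] ℝ) 0 := by
    have := ((linComb p).hasFDerivAt (x := 0)).norm_sq
    simpa using this
  have h2 : HasFDerivAt (fun x => (√(1 + ‖linComb p x‖ ^ 2))⁻¹) (0 : E4 →L[ℝ] ℝ) 0 := by
    have h3 : DifferentiableAt ℝ (fun s : ℝ => (√(1 + s))⁻¹) (‖linComb p 0‖ ^ 2) :=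
      ((differentiableAt_id.const_add 1).sqrt (by simp)).inv (by simp)
    exact (HasDerivAt.comp_hasFDerivAt (f := fun x => ‖linComb p x‖ ^ 2) (0 : E4)
      h3.hasDerivAt h1).congr_fderiv (smul_zero _)
  have h4 : HasFDerivAt (fun x => 1 - linComb p x) (-linComb p) 0 :=
    (linComb p).hasFDerivAt.const_sub 1
  have h5 := h2.smul (h4.mul_const' q)
  refine (congrArg (fun L => L (e l)) h5.fderiv).trans ?_
  simp [linComb_e]

lemma gaugeAct_centerGauge_zero (q : H) (l : Fin 4) :
    gaugeAct (centerGauge (fun l => A l 0) q) A l 0 = 0 := by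
  rw [gaugeAct, centerGauge_zero, fderiv_centerGauge_zero]
  simp [mul_assoc]

/-! ### The choice of the relative rotation -/

lemma asdPart_eq_zero {α : TwoCovector} (hα : IsAlt α) (h : ∀ k, asdVec α k = 0) :
    asdPart α = 0 := by
  have h1 := h 0
  have h2 := h 1
  have h3 := h 2
  simp only [asdVec, Matrix.cons_val_zero, Matrix.cons_val_one, Matrix.cons_val, smul_eq_zero,
    one_div, inv_eq_zero, OfNat.ofNat_ne_zero, false_or] at h1 h2 h3
  have e1 : α 2 3 = α 0 1 := (sub_eq_zero.mp h1).symm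
  have e2 : α 1 3 = -α 0 2 := by rw [eq_neg_iff_add_eq_zero, add_comm]; exact h2
  have e3 : α 1 2 = α 0 3 := (sub_eq_zero.mp h3).symm
  have key : ∀ l m, α l m = hodge α l m := by
    intro l m
    fin_cases l <;> fin_cases m <;>
      simp [hodge, hα.diag, hα.skew 1 0, hα.skew 2 0, hα.skew 3 0, hα.skew 2 1, hα.skew 3 1,
        hα.skew 3 2, e1, e2, e3]
  funext l m
  simp only [asdPart, Pi.smul_apply, Pi.sub_apply, ← key, sub_self, smul_zero]
  rfl

lemma norm_toQuat_mk {w x y z : ℝ} (h : w ^ 2 + x ^ 2 + y ^ 2 + z ^ 2 = 1) :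
    ‖toQuat !₂[w, x, y, z]‖ = 1 := by
  rw [← sq_eq_sq₀ (norm_nonneg _) zero_le_one, norm_sq_eq, one_pow]
  exact h

lemma pairing_conjTwo {α : TwoCovector} {w x y z : ℝ} (h : w ^ 2 + x ^ 2 + y ^ 2 + z ^ 2 = 1) :
    pairing (conjTwo (toQuat !₂[w, x, y, z]) α) =
      ((w ^ 2 + x ^ 2 - y ^ 2 - z ^ 2) * (asdVec α 0).imI
        + 2 * (x * y + w * z) * (asdVec α 0).imJ + 2 * (x * z - w * y) * (asdVec α 0).imK)
      + (2 * (x * y - w * z) * (asdVec α 1).imI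
        + (w ^ 2 - x ^ 2 + y ^ 2 - z ^ 2) * (asdVec α 1).imJ
        + 2 * (y * z + w * x) * (asdVec α 1).imK)
      + (2 * (x * z + w * y) * (asdVec α 2).imI + 2 * (y * z - w * x) * (asdVec α 2).imJ
        + (w ^ 2 - x ^ 2 - y ^ 2 + z ^ 2) * (asdVec α 2).imK) := by
  simp only [pairing, asdVec_conjTwo, inv_eq_star_of_norm_eq_one (norm_toQuat_mk h),
    Quaternion.inner_def, Fin.sum_univ_three, unitIm]
  simp [e_apply]
  ring

/-- The twelve rotations of the tetrahedral group act irreducibly on `su(2)`: if none of them gave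
a positive pairing, all matrix entries of the anti-self-dual part would vanish. -/
lemma exists_pairing_pos {α : TwoCovector} (hα : IsAlt α) (h : asdPart α ≠ 0) :
    ∃ q : H, ‖q‖ = 1 ∧ 0 < pairing (conjTwo q α) := by
  by_contra! hneg
  refine h (asdPart_eq_zero hα ?_)
  have key := fun (w x y z : ℝ) (hw : w ^ 2 + x ^ 2 + y ^ 2 + z ^ 2 = 1) =>
    (pairing_conjTwo (α := α) hw).ge.trans (hneg _ (norm_toQuat_mk hw))
  have re0 : ∀ k, (asdVec α k).re = 0 := by
    intro k; fin_cases k <;> simp [asdVec, hα.re]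
  have a1 := key 1 0 0 0 (by norm_num)
  have a2 := key 0 1 0 0 (by norm_num)
  have a3 := key 0 0 1 0 (by norm_num)
  have a4 := key 0 0 0 1 (by norm_num)
  have b1 := key (1 / 2) (1 / 2) (1 / 2) (1 / 2) (by norm_num)
  have b2 := key (1 / 2) (1 / 2) (-1 / 2) (-1 / 2) (by norm_num)
  have b3 := key (1 / 2) (-1 / 2) (1 / 2) (-1 / 2) (by norm_num)
  have b4 := key (1 / 2) (-1 / 2) (-1 / 2) (1 / 2) (by norm_num)
  have c1 := key (1 / 2) (-1 / 2) (-1 / 2) (-1 / 2) (by norm_num)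
  have c2 := key (1 / 2) (-1 / 2) (1 / 2) (1 / 2) (by norm_num)
  have c3 := key (1 / 2) (1 / 2) (-1 / 2) (1 / 2) (by norm_num)
  have c4 := key (1 / 2) (1 / 2) (1 / 2) (-1 / 2) (by norm_num)
  norm_num at a1 a2 a3 a4 b1 b2 b3 b4 c1 c2 c3 c4
  intro k
  fin_cases k <;> ext
  all_goals simp only [Fin.zero_eta, Fin.mk_one, Fin.reduceFinMk, re0, Quaternion.re_zero,
    Quaternion.imI_zero, Quaternion.imJ_zero, Quaternion.imK_zero]
  all_goals linarith

end

/-! ### Gluing in a self-dual instanton -/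

section

variable {A : OneForm}

/-- After a global gauge transformation the connection vanishes at the origin and its
anti-self-dual curvature there pairs positively with `dx̄ ∧ dx`. -/
lemma exists_centered_gauge (hA : IsConnection A) (h : asdPart (curv A 0) ≠ 0) :
    ∃ g : E4 → H, ContDiff ℝ ∞ g ∧ (∀ x, ‖g x‖ = 1) ∧ (∀ l, gaugeAct g A l 0 = 0) ∧
      0 < pairing (curv (gaugeAct g A) 0) := by
  obtain ⟨q, hq, hpos⟩ := exists_pairing_pos (hA.isAlt_curv 0) h
  have hg := contDiff_centerGauge (fun l => A l 0) q
  have hu := norm_centerGauge (p := fun l => A l 0) (fun l => (hA l).2 0) hq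
  refine ⟨_, hg, hu, gaugeAct_centerGauge_zero q, ?_⟩
  rw [curv_gaugeAct_global hg hu hA, centerGauge_zero]
  exact hpos

lemma gaugeEquivOn_glue {m S T : ℝ} (hm : 0 < m) (hS : 0 < S) (hT : 0 < T) (hTS : 2 * T ≤ S)
    {g : E4 → H} (hg : ContDiff ℝ ∞ g) (hu : ∀ x, ‖g x‖ = 1) {r : ℝ} (hr : 0 < r)
    (hrS : S ≤ r ^ 2) :
    GaugeEquivOn (Metric.ball (0 : E4) r)ᶜ A (glue m S T (gaugeAct g A)) := by
  have hle : ∀ x ∈ (Metric.ball (0 : E4) r)ᶜ, r ≤ ‖x‖ := fun x hx => by simpa using hx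
  refine ⟨{0}ᶜ, fun x => g x * invMap x, isOpen_compl_singleton, fun x hx => ?_,
    fun x hx => ?_, fun x hx => ?_, fun x hx l => ?_⟩
  · exact norm_pos_iff.mp (hr.trans_le (hle x hx))
  · exact (hg.contDiffAt.mul (contDiffAt_invMap hx)).contDiffWithinAt
  · rw [norm_mul, hu, norm_invMap hx, one_mul]
  · have hx0 : x ≠ 0 := norm_pos_iff.mp (hr.trans_le (hle x hx))
    rw [glue_eq_gaugeAct_of_le hm hS hT hTS (hrS.trans (pow_le_pow_left₀ hr.le (hle x hx) 2)),
      gaugeAct_gaugeAct (hg.differentiable (by simp) x)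
        ((contDiffAt_invMap hx0).differentiableAt (by simp)) (ne_zero_of_norm_eq_one (hu x))]
    rfl

lemma gaugeEquivOn_of_eq {U : Set E4} {A B : OneForm} (h : ∀ x ∈ U, ∀ l, B l x = A l x) :
    GaugeEquivOn U A B :=
  ⟨Set.univ, fun _ => 1, isOpen_univ, Set.subset_univ _, contDiffOn_const, fun _ _ => norm_one,
    fun x hx l => by simp [h x hx l]⟩

lemma tendsto_rpow_nhdsGT_zero {p : ℝ} (hp : 0 < p) :
    Tendsto (fun ρ : ℝ => ρ ^ p) (𝓝[>] 0) (𝓝 0) := by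
  have h := (Real.continuousAt_rpow_const 0 p (Or.inr hp.le)).tendsto
  rw [Real.zero_rpow hp.ne'] at h
  exact h.mono_left nhdsWithin_le_nhds

/-- The scales of the construction: `m = K ρ⁴` for the squared size of the instanton, `S = ρ^(2b)`
and `T = ρ^(2a)` for the squared radii of the outer and inner transition regions. -/
lemma eventually_scales {a b c C s₀ k K : ℝ} (ha : 1 < a) (hb : b < 1) (hab : a < 2 * b)
    (hc : 0 < c) (hs : 0 < s₀) (hk : 0 < k) (hK : 0 < K) :
    ∀ᶠ ρ : ℝ in 𝓝[>] 0, 4 * ρ ^ (2 * a) < ρ ^ (2 * b) ∧ K * ρ ^ (4 : ℝ) ≤ ρ ^ (2 * a) ∧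
      K * ρ ^ (4 : ℝ) ≤ k * (ρ ^ (2 * b)) ^ 2 ∧ ρ ^ (2 * b) ≤ s₀ ∧
      C * (K * ρ ^ (4 : ℝ) / ρ ^ (2 * a) * (ρ ^ (2 * b)) ^ 2 + (ρ ^ (2 * a)) ^ 2) ≤
        c / 2 * (K * ρ ^ (4 : ℝ)) := by
  have t1 := tendsto_rpow_nhdsGT_zero (p := 2 * a - 2 * b) (by linarith)
  have t2 := tendsto_rpow_nhdsGT_zero (p := 4 - 2 * a) (by linarith)
  have t3 := tendsto_rpow_nhdsGT_zero (p := 4 - 4 * b) (by linarith)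
  have t4 := tendsto_rpow_nhdsGT_zero (p := 2 * b) (by linarith)
  have t5 := tendsto_rpow_nhdsGT_zero (p := 4 * b - 2 * a) (by linarith)
  have t6 := tendsto_rpow_nhdsGT_zero (p := 4 * a - 4) (by linarith)
  have u1 := (t1.const_mul 4).eventually (gt_mem_nhds (show (4 : ℝ) * 0 < 1 by norm_num))
  have u2 := (t2.const_mul K).eventually (gt_mem_nhds (show K * 0 < 1 by norm_num))
  have u3 := (t3.const_mul K).eventually (gt_mem_nhds (show K * 0 < k by simpa using hk))
  have u4 := t4.eventually (gt_mem_nhds hs)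
  have u5 := (((t5.const_mul K).add t6).const_mul C).eventually
    (gt_mem_nhds (show C * (K * 0 + 0) < c / 2 * K by simp; positivity))
  filter_upwards [u1, u2, u3, u4, u5, self_mem_nhdsWithin] with ρ h1 h2 h3 h4 h5 hρ
  have hρ0 : 0 < ρ := hρ
  have e1 : ρ ^ (2 * a) = ρ ^ (2 * a - 2 * b) * ρ ^ (2 * b) := by
    rw [← Real.rpow_add hρ0]; congr 1; ring
  have e2 : ρ ^ (4 : ℝ) = ρ ^ (4 - 2 * a) * ρ ^ (2 * a) := by
    rw [← Real.rpow_add hρ0]; congr 1; ring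
  have e3 : ρ ^ (4 : ℝ) = ρ ^ (4 - 4 * b) * (ρ ^ (2 * b)) ^ 2 := by
    rw [← Real.rpow_mul_natCast hρ0.le, ← Real.rpow_add hρ0]; congr 1; push_cast; ring
  have e4 : ρ ^ (4 : ℝ) / ρ ^ (2 * a) * (ρ ^ (2 * b)) ^ 2 = ρ ^ (4 * b - 2 * a) * ρ ^ (4 : ℝ) := by
    rw [← Real.rpow_mul_natCast hρ0.le, ← Real.rpow_sub hρ0, ← Real.rpow_add hρ0,
      ← Real.rpow_add hρ0]
    congr 1; push_cast; ring
  have e5 : (ρ ^ (2 * a)) ^ 2 = ρ ^ (4 * a - 4) * ρ ^ (4 : ℝ) := by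
    rw [← Real.rpow_mul_natCast hρ0.le, ← Real.rpow_add hρ0]; congr 1; push_cast; ring
  have p1 : 0 < ρ ^ (2 * b) := Real.rpow_pos_of_pos hρ0 _
  have p2 : 0 < ρ ^ (2 * a) := Real.rpow_pos_of_pos hρ0 _
  have p3 : 0 < ρ ^ (4 : ℝ) := Real.rpow_pos_of_pos hρ0 _
  refine ⟨?_, ?_, ?_, h4.le, ?_⟩
  · rw [e1]; nlinarith
  · rw [e2]; nlinarith
  · rw [e3]; nlinarith [pow_pos p1 2]
  · rw [mul_div_assoc, mul_assoc K, e4, e5]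
    nlinarith

/-- The instanton of squared size `K ρ⁴` gains an energy proportional to `K`, so that any
prescribed multiple of `ρ⁴` can be gained. -/
theorem exists_glued_instanton {a b : ℝ} (hb1 : b < 1) (ha : 1 < a) (hA : IsConnection A)
    (hi : FiniteEnergy A) (h : asdPart (curv A 0) ≠ 0) {P : ℝ} (hP : 0 ≤ P) :
    ∃ ρ₀ : ℝ, 0 < ρ₀ ∧ ∀ ρ : ℝ, 0 < ρ → ρ < ρ₀ →
      ∃ A' : OneForm, IsConnection A' ∧ FiniteEnergy A' ∧
        GaugeEquivOn (Metric.ball (0 : E4) (ρ ^ b))ᶜ A A' ∧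
        (∃ s : ℝ, 0 < s ∧ GaugeEquivOn (Metric.ball (0 : E4) (ρ ^ a)) (SD s) A') ∧
        chern A' = chern A - 8 * Real.pi ^ 2 ∧
        YM A' ≤ YM A + 8 * Real.pi ^ 2 - P * ρ ^ 4 := by
  obtain ⟨g, hg, hu, hg0, hpos⟩ := exists_centered_gauge hA h
  have hB := isConnection_gaugeAct hg hu hA
  have hBi := finiteEnergy_gaugeAct hg hu hA hi
  obtain ⟨c, C, s₀, k, hc, hs, hk, hYM⟩ := YM_glue_le hB hBi hg0 hpos
  -- The exponents may be moved towards `1`, which makes the transition region smaller.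
  set a' := min a (11 / 10) with ha'
  set b' := max b (9 / 10) with hb'
  have ha1 : 1 < a' := lt_min ha (by norm_num)
  have hb1' : b' < 1 := max_lt hb1 (by norm_num)
  have ha2 : a' ≤ 11 / 10 := min_le_right _ _
  have hb2 : 9 / 10 ≤ b' := le_max_right _ _
  -- Half of the gain `c K ρ⁴` absorbs the errors; the other half exceeds `P ρ⁴`.
  set K := 2 * (P + 1) / c with hK
  have hK0 : 0 < K := by positivity
  have hev := (eventually_scales (C := C) ha1 hb1' (by linarith) hc hs hk hK0).and
    (Ioo_mem_nhdsGT (zero_lt_one' ℝ))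
  obtain ⟨ρ₀, hρ₀, hsub⟩ := (mem_nhdsGT_iff_exists_Ioo_subset).mp hev
  refine ⟨ρ₀, hρ₀, fun ρ hρ hρρ => ?_⟩
  obtain ⟨⟨h1, h2, h3, h4, h5⟩, hρ1⟩ := hsub ⟨hρ, hρρ⟩
  have hm : 0 < K * ρ ^ (4 : ℝ) := by positivity
  have hS : 0 < ρ ^ (2 * b') := by positivity
  have hT : 0 < ρ ^ (2 * a') := by positivity
  have hsq : ∀ p : ℝ, ρ ^ (2 * p) = (ρ ^ p) ^ 2 := fun p => by
    rw [← Real.rpow_mul_natCast hρ.le]; congr 1; push_cast; ring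
  refine ⟨glue (K * ρ ^ (4 : ℝ)) (ρ ^ (2 * b')) (ρ ^ (2 * a')) (gaugeAct g A),
    isConnection_glue hm hS hT hB, finiteEnergy_glue hm hS hT hB hBi, ?_, ?_, ?_, ?_⟩
  · refine gaugeEquivOn_glue hm hS hT (by linarith) hg hu (by positivity) ?_
    rw [hsq]
    exact pow_le_pow_left₀ (by positivity)
      (Real.rpow_le_rpow_of_exponent_ge hρ hρ1.2.le (le_max_left _ _)) 2
  · refine ⟨(√(K * ρ ^ (4 : ℝ)))⁻¹, by positivity, gaugeEquivOn_of_eq fun x hx l => ?_⟩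
    refine glue_eq_SD hm hS hT (by linarith) ?_ l
    have hx' : ‖x‖ < ρ ^ a := by simpa using hx
    rw [hsq]
    exact pow_le_pow_left₀ (norm_nonneg _) (hx'.le.trans
      (Real.rpow_le_rpow_of_exponent_ge hρ hρ1.2.le (min_le_left _ _))) 2
  · rw [chern_glue hm hS hT hB hBi, chern_gaugeAct hg hu hA]
  · have hY := hYM _ _ _ hm hS hT h1 h2 h3 h4
    rw [YM_gaugeAct hg hu hA] at hY
    have e1 : ρ ^ (4 : ℝ) = ρ ^ 4 := by exact_mod_cast Real.rpow_natCast ρ 4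
    have e2 : c / 2 * (K * ρ ^ (4 : ℝ)) = (P + 1) * ρ ^ 4 := by
      rw [hK, e1]; field_simp
    have e3 : 0 < ρ ^ 4 := by positivity
    linarith

end

/-! ### Reversal of the orientation -/

section

variable {A : OneForm}

/-- The sign of the coordinate `x_l` under `x ↦ x̄`. -/
def sgn (l : Fin 4) : ℝ := if l = 0 then 1 else -1

lemma sgn_mul_self (l : Fin 4) : sgn l * sgn l = 1 := by
  unfold sgn; split_ifs <;> norm_num

/-- The reflection `x ↦ x̄` of four-space. -/
def refl : E4 ≃ₗᵢ[ℝ] E4 := LinearIsometryEquiv.piLpCongrRight 2 fun l : Fin 4 =>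
  if l = 0 then LinearIsometryEquiv.refl ℝ ℝ else LinearIsometryEquiv.neg ℝ

lemma refl_apply (x : E4) (l : Fin 4) : refl x l = sgn l * x l := by
  simp only [refl, sgn, LinearIsometryEquiv.piLpCongrRight_apply]
  split_ifs <;> simp

lemma refl_refl (x : E4) : refl (refl x) = x := by
  ext l; rw [refl_apply, refl_apply, ← mul_assoc, sgn_mul_self, one_mul]

lemma refl_e (l : Fin 4) : refl (e l) = sgn l • e l := by
  ext n
  rw [refl_apply, PiLp.smul_apply, smul_eq_mul, e_apply]
  split_ifs with h
  · rw [h]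
  · simp

lemma toQuat_refl (x : E4) : toQuat (refl x) = star (toQuat x) := by
  ext <;> simp [refl_apply, sgn]

/-- The pullback of a one-form under the reflection. -/
def pullback (A : OneForm) : OneForm := fun l x => sgn l • A l (refl x)

/-- The pullback of a two-covector under the reflection. -/
def twist (α : TwoCovector) : TwoCovector := fun l m => (sgn l * sgn m) • α l m

lemma pullback_pullback (A : OneForm) : pullback (pullback A) = A := by
  funext l x
  simp only [pullback, refl_refl, smul_smul, sgn_mul_self, one_smul]

lemma isConnection_pullback (hA : IsConnection A) : IsConnection (pullback A) := fun l =>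
  ⟨((hA l).1.comp refl.contDiff).const_smul (sgn l), fun x => by simp [pullback, (hA l).2]⟩

lemma fderiv_comp_refl {f : E4 → H} {x : E4} (hf : DifferentiableAt ℝ f (refl x)) (l : Fin 4) :
    fderiv ℝ (fun y => f (refl y)) x (e l) = sgn l • fderiv ℝ f (refl x) (e l) := by
  have h := hf.hasFDerivAt.comp x refl.toContinuousLinearEquiv.hasFDerivAt
  refine (congrArg (fun L => L (e l)) h.fderiv).trans ?_
  simp [refl_e]

lemma curv_pullback (hA : IsConnection A) (x : E4) :
    curv (pullback A) x = twist (curv A (refl x)) := by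
  have h : ∀ l m, fderiv ℝ (pullback A m) x (e l) =
      (sgn l * sgn m) • fderiv ℝ (A m) (refl x) (e l) := by
    intro l m
    have hd : DifferentiableAt ℝ (fun y => A m (refl y)) x :=
      (hA.differentiableAt _ m).comp x refl.differentiableAt
    refine (congrArg (fun L => L (e l)) (fderiv_fun_const_smul hd (sgn m))).trans ?_
    rw [smul_apply, fderiv_comp_refl (hA.differentiableAt _ m), smul_smul, mul_comm]
  funext l m
  simp only [curv, twist, h]
  simp only [pullback, smul_mul_smul_comm]
  rw [mul_comm (sgn m) (sgn l)]
  module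

lemma twoNormSq_twist (α : TwoCovector) : twoNormSq (twist α) = twoNormSq α := by
  simp [twoNormSq_expand, twist, sgn]

lemma trWedge_twist (α : TwoCovector) : trWedge (twist α) = -trWedge α := by
  simp [trWedge, twist, sgn, qtr]
  ring

lemma asdPart_twist (α : TwoCovector) : asdPart (twist α) = twist (sdPart α) := by
  have h : ∀ l m, hodge (twist α) l m = -twist (hodge α) l m := by
    intro l m
    fin_cases l <;> fin_cases m <;> simp [hodge, twist, sgn]
  funext l m
  simp only [asdPart, Pi.smul_apply, Pi.sub_apply, h]
  simp only [twist, sdPart, Pi.smul_apply, Pi.add_apply]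
  module

lemma measurePreserving_refl : MeasurePreserving refl (volume : Measure E4) volume :=
  refl.measurePreserving

lemma integral_comp_refl (f : E4 → ℝ) : ∫ x, f (refl x) = ∫ x, f x :=
  measurePreserving_refl.integral_comp refl.toHomeomorph.measurableEmbedding f

lemma YM_pullback (hA : IsConnection A) : YM (pullback A) = YM A := by
  simp only [YM, curv_pullback hA, twoNormSq_twist]
  exact integral_comp_refl fun x => twoNormSq (curv A x)

lemma chern_pullback (hA : IsConnection A) : chern (pullback A) = -chern A := by
  simp only [chern, curv_pullback hA, trWedge_twist, integral_neg]
  rw [integral_comp_refl fun x => trWedge (curv A x)]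

lemma finiteEnergy_pullback (hA : IsConnection A) (hi : FiniteEnergy A) :
    FiniteEnergy (pullback A) := by
  simp only [FiniteEnergy, curv_pullback hA, twoNormSq_twist]
  exact measurePreserving_refl.integrable_comp_of_integrable hi

lemma pullback_SD (s : ℝ) : pullback (SD s) = ASD s := by
  funext l x
  have h : star (toQuat (e l)) = sgn l • toQuat (e l) := by
    rw [← toQuat_refl, refl_e]
    exact toQuatL.map_smul (sgn l) (e l)
  simp only [pullback, SD, ASD, LinearIsometryEquiv.norm_map, toQuat_refl, h, mul_smul_comm,
    Quaternion.im_smul]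
  rw [smul_comm, smul_smul, smul_smul, mul_assoc, sgn_mul_self, mul_one]

lemma gaugeEquivOn_pullback {U : Set E4} (hU : ∀ x ∈ U, refl x ∈ U) {A B : OneForm}
    (h : GaugeEquivOn U A B) : GaugeEquivOn U (pullback A) (pullback B) := by
  obtain ⟨V, g, hV, hUV, hg, hu, hAB⟩ := h
  refine ⟨refl ⁻¹' V, fun x => g (refl x), hV.preimage refl.continuous,
    fun x hx => hUV (hU x hx), hg.comp refl.contDiff.contDiffOn fun x hx => hx,
    fun x hx => hu _ hx, fun x hx l => ?_⟩
  have hd : DifferentiableAt ℝ g (refl x) :=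
    (hg.contDiffAt (hV.mem_nhds (hUV (hU x hx)))).differentiableAt (by simp)
  rw [fderiv_comp_refl hd, pullback, pullback, hAB _ (hU x hx)]
  simp only [smul_add, mul_smul_comm, smul_mul_assoc]

/-- The mirror image of `exists_glued_instanton`: the reflection exchanges self-dual and
anti-self-dual forms and reverses the sign of the Chern integral. -/
theorem exists_glued_anti_instanton {a b : ℝ} (hb1 : b < 1) (ha : 1 < a) (hA : IsConnection A)
    (hi : FiniteEnergy A) (h : sdPart (curv A 0) ≠ 0) {P : ℝ} (hP : 0 ≤ P) :
    ∃ ρ₀ : ℝ, 0 < ρ₀ ∧ ∀ ρ : ℝ, 0 < ρ → ρ < ρ₀ →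
      ∃ A' : OneForm, IsConnection A' ∧ FiniteEnergy A' ∧
        GaugeEquivOn (Metric.ball (0 : E4) (ρ ^ b))ᶜ A A' ∧
        (∃ s : ℝ, 0 < s ∧ GaugeEquivOn (Metric.ball (0 : E4) (ρ ^ a)) (ASD s) A') ∧
        chern A' = chern A + 8 * Real.pi ^ 2 ∧
        YM A' ≤ YM A + 8 * Real.pi ^ 2 - P * ρ ^ 4 := by
  have hB := isConnection_pullback hA
  have h' : asdPart (curv (pullback A) 0) ≠ 0 := by
    rw [curv_pullback hA, map_zero, asdPart_twist]
    intro h0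
    refine h ?_
    funext l m
    have h1 := congrFun (congrFun h0 l) m
    have h2 : sgn l * sgn m ≠ 0 := mul_ne_zero (left_ne_zero_of_mul_eq_one (sgn_mul_self l))
      (left_ne_zero_of_mul_eq_one (sgn_mul_self m))
    exact (smul_eq_zero_iff_right h2).mp h1
  obtain ⟨ρ₀, hρ₀, H⟩ := exists_glued_instanton hb1 ha hB (finiteEnergy_pullback hA hi) h' hP
  refine ⟨ρ₀, hρ₀, fun ρ hρ hρρ => ?_⟩
  obtain ⟨B', hB', hi', h1, ⟨s, hs, h2⟩, h3, h4⟩ := H ρ hρ hρρ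
  refine ⟨pullback B', isConnection_pullback hB', finiteEnergy_pullback hB' hi', ?_,
    ⟨s, hs, ?_⟩, ?_, ?_⟩
  · have := gaugeEquivOn_pullback (fun x hx => by simpa using hx) h1
    rwa [pullback_pullback] at this
  · have := gaugeEquivOn_pullback (fun x hx => by simpa using hx) h2
    rwa [pullback_SD] at this
  · rw [chern_pullback hB', h3, chern_pullback hA]; ring
  · rwa [YM_pullback hB', ← YM_pullback hA]

end

end YangMillsFour

end

open YangMillsFour in
theorem theorem1p2 (a b : ℝ) (hb0 : 0 < b) (hb1 : b < 1) (ha : 1 < a) :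
    ∃ δ : ℝ, 0 < δ ∧
      (∀ A : OneForm, IsConnection A → FiniteEnergy A → asdPart (curv A 0) ≠ 0 →
        ∃ C ρ₀ : ℝ, 0 < ρ₀ ∧ ∀ ρ : ℝ, 0 < ρ → ρ < ρ₀ →
          ∃ A' : OneForm, IsConnection A' ∧ FiniteEnergy A' ∧
            GaugeEquivOn (Metric.ball (0 : E4) (ρ ^ b))ᶜ A A' ∧
            (∃ s : ℝ, 0 < s ∧ GaugeEquivOn (Metric.ball (0 : E4) (ρ ^ a)) (SD s) A') ∧
            chern A' = chern A - 8 * Real.pi ^ 2 ∧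
            YM A' ≤ YM A + 8 * Real.pi ^ 2
              - 4 * Real.pi ^ 2 / Real.sqrt 3 * twoNormSq (asdPart (curv A 0)) * ρ ^ 4
              + C * ρ ^ (4 + δ)) ∧
      (∀ A : OneForm, IsConnection A → FiniteEnergy A → sdPart (curv A 0) ≠ 0 →
        ∃ C ρ₀ : ℝ, 0 < ρ₀ ∧ ∀ ρ : ℝ, 0 < ρ → ρ < ρ₀ →
          ∃ A' : OneForm, IsConnection A' ∧ FiniteEnergy A' ∧
            GaugeEquivOn (Metric.ball (0 : E4) (ρ ^ b))ᶜ A A' ∧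
            (∃ s : ℝ, 0 < s ∧ GaugeEquivOn (Metric.ball (0 : E4) (ρ ^ a)) (ASD s) A') ∧
            chern A' = chern A + 8 * Real.pi ^ 2 ∧
            YM A' ≤ YM A + 8 * Real.pi ^ 2
              - 4 * Real.pi ^ 2 / Real.sqrt 3 * twoNormSq (sdPart (curv A 0)) * ρ ^ 4
              + C * ρ ^ (4 + δ)) := by
  -- Any multiple of `ρ⁴` can be gained, so no remainder is needed: `C = 0`, and `δ` is arbitrary.
  refine ⟨1, one_pos, fun A hA hi h => ?_, fun A hA hi h => ?_⟩
  · have hP : 0 ≤ 4 * Real.pi ^ 2 / Real.sqrt 3 * twoNormSq (asdPart (curv A 0)) :=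
      mul_nonneg (by positivity) (twoNormSq_nonneg _)
    obtain ⟨ρ₀, hρ₀, H⟩ := exists_glued_instanton hb1 ha hA hi h hP
    refine ⟨0, ρ₀, hρ₀, ?_⟩
    simpa only [zero_mul, add_zero] using H
  · have hP : 0 ≤ 4 * Real.pi ^ 2 / Real.sqrt 3 * twoNormSq (sdPart (curv A 0)) :=
      mul_nonneg (by positivity) (twoNormSq_nonneg _)
    obtain ⟨ρ₀, hρ₀, H⟩ := exists_glued_anti_instanton hb1 ha hA hi h hP
    refine ⟨0, ρ₀, hρ₀, ?_⟩
    simpa only [zero_mul, add_zero] using H
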